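/- For $q\in\mathbb{Z}$ let $BS(1,q)=\langle a,b\mid aba^{-1}=b^{q}\rangle$ (so $BS(1,0)\cong\mathbb{Z}$). A left-order on a group $G$ is a strict total order $\prec$ on $G$ with $g\prec h\iff fg\prec fh$ for all $f,g,h\in G$; its positive cone is $P_\prec=\{g\in G: 1\prec g\}$. A finite generating set of $G$ is a finite set $X$ with a surjective monoid homomorphism $\pi\colon X^*\to G$. The left-order $\prec$ is *regular* (respectively *one-counter*) with respect to $(X,\pi)$ if $\pi(\mathcal L)=P_\prec$ for some regular (respectively one-counter) language $\mathcal L\subseteq X^*$; a language is one-counter if it is accepted, by final state, by a nondeterministic pushdown automaton with finitely many states, whose stack alphabet has exactly one letter and whose moves may depend on whether the stack is empty. **Theorem.** Let $q\in\mathbb{Z}$ and let $(X,\pi)$ be any finite generating set of $BS(1,q)$. Then: 1. $BS(1,q)$ admits a left-order that is one-counter with respect to $(X,\pi)$. 2. $BS(1,q)$ admits a left-order that is regular with respect to $(X,\pi)$ if and only if $q\ge -1$. 3. If $q\ge 2$, then every left-order $\prec$ on $BS(1,q)$ that is regular with respect to $(X,\pi)$ is induced by the affine action of $BS(1,q)$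 on $\mathbb{R}$ given by $a\colon x\mapsto qx$, $b\colon x\mapsto x+1$. That is, there are a point $x\in\mathbb{R}$ and a left-order $\prec'$ on the stabilizer $\mathrm{Stab}(x)$, with positive cone $P'$, such that either, for all $g,h\in BS(1,q)$, $$g\prec h\iff g(x)<h(x)\ \text{ or }\ g^{-1}h\in P',$$ or, for all $g,h\in BS(1,q)$, $$g\prec h\iff g(x)>h(x)\ \text{ or }\ g^{-1}h\in P'.$$ -/

import Mathlib

/-! ### Pushdown automata and one-counter languages -/

/-- A nondeterministic pushdown automaton with input alphabet `X`, state set `S` and stack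
alphabet `Γ`. In `δ s o t`, `o = none` is a spontaneous move (no input letter is read), and `t` is
the last letter of the stack word, with `t = none` when the stack is empty. -/
structure PDA (X S Γ : Type*) where
  /-- the transition function -/
  δ : S → Option X → Option Γ → Set (S × List Γ)
  finite_δ : ∀ s o t, (δ s o t).Finite
  /-- the initial state -/
  start : S
  /-- the initial stack word -/
  stack₀ : List Γ
  /-- the accepting states -/
  accept : Set S

namespace PDA

variable {X S Γ : Type*}

/-- One move: in state `s` with stack word `u`, the last letter of `u` (if any) is deleted and
a word is appended, as allowed by the transition function. -/
def Step (M : PDA X S Γ) (c : S × List Γ) (o : Option X) (c' : S × List Γ) : Prop :=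
  ∃ v : List Γ, (c'.1, v) ∈ M.δ c.1 o c.2.getLast? ∧ c'.2 = c.2.dropLast ++ v

/-- `M.Run c w c'`: some finite sequence of moves leads from the configuration `c` to `c'` while
reading exactly the word `w`. -/
inductive Run (M : PDA X S Γ) : S × List Γ → List X → S × List Γ → Prop
  | nil (c : S × List Γ) : Run M c [] c
  | cons {c c' c'' : S × List Γ} {o : Option X} {w : List X} :
      M.Step c o c' → Run M c' w c'' → Run M c (o.toList ++ w) c''

/-- The language accepted by `M` (acceptance by state, with any final stack word). -/
def accepts (M : PDA X S Γ) : Language X :=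
  {w | ∃ c : S × List Γ, M.Run (M.start, M.stack₀) w c ∧ c.1 ∈ M.accept}

end PDA

/-- A language is one-counter if it is accepted by a nondeterministic pushdown automaton with
finitely many states whose stack alphabet has exactly one letter. -/
def IsOneCounter {X : Type*} (L : Language X) : Prop :=
  ∃ (S Γ : Type) (_ : Finite S) (M : PDA X S Γ), Nat.card Γ = 1 ∧ M.accepts = L

/-! ### Left-orders, and left-orders described by languages -/

/-- `lt` is a (strict) total order on `G` that is invariant under left multiplication. -/
structure IsLeftOrder {G : Type*} [Group G] (lt : G → G → Prop) : Prop where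
  strictTotal : IsStrictTotalOrder G lt
  mul_left_iff : ∀ f g h : G, lt (f * g) (f * h) ↔ lt g h

/-- The positive cone of a left-order. -/
def posCone {G : Type*} [Group G] (lt : G → G → Prop) : Set G := {g | lt 1 g}

/-- Some language over `X` that belongs to the class `C` evaluates onto `P` under `π`. -/
def IsRepresentedBy {X G : Type*} [Group G] (C : Language X → Prop) (π : FreeMonoid X →* G)
    (P : Set G) : Prop :=
  ∃ L : Language X, C L ∧ {g : G | ∃ w ∈ L, π (FreeMonoid.ofList w) = g} = P

/-- `lt` is a regular left-order with respect to the generating set `(X, π)`. -/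
def IsRegularLeftOrder {X G : Type*} [Group G] (π : FreeMonoid X →* G) (lt : G → G → Prop) :
    Prop :=
  IsLeftOrder lt ∧ IsRepresentedBy Language.IsRegular π (posCone lt)

/-- `lt` is a one-counter left-order with respect to the generating set `(X, π)`. -/
def IsOneCounterLeftOrder {X G : Type*} [Group G] (π : FreeMonoid X →* G) (lt : G → G → Prop) :
    Prop :=
  IsLeftOrder lt ∧ IsRepresentedBy IsOneCounter π (posCone lt)

/-! ### Left-orders induced by an action on a totally ordered set -/

/-- The stabilizer of the point `x` under an order-preserving action. -/
def stabAt {G Ω : Type*} [Group G] [LinearOrder Ω] (ρ : G →* (Ω ≃o Ω)) (x : Ω) : Subgroup G where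
  carrier := {g | ρ g x = x}
  one_mem' := by simp
  mul_mem' := by
    intro g h hg hh
    simp only [Set.mem_ofPred_eq, map_mul, RelIso.mul_apply] at *
    rw [hh, hg]
  inv_mem' := by
    intro g hg
    simp only [Set.mem_ofPred_eq] at *
    conv_lhs => rw [← hg]
    rw [← RelIso.mul_apply, ← map_mul]
    simp

/-- The left-order `lt` is induced by the order-preserving action `ρ`: for some base point `x`, two
elements of `G` are compared by the positions of the images of `x` on the line (in its usual
orientation, or in the opposite one), and ties are decided by a left-order on the stabilizer
of `x`. -/
def IsInducedBy {G Ω : Type*} [Group G] [LinearOrder Ω] (ρ : G →* (Ω ≃o Ω)) (lt : G → G → Prop) :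
    Prop :=
  ∃ (x : Ω) (lt' : stabAt ρ x → stabAt ρ x → Prop), IsLeftOrder lt' ∧
    ((∀ g h : G, lt g h ↔
        ρ g x < ρ h x ∨ ∃ s : stabAt ρ x, h = g * (s : G) ∧ lt' 1 s) ∨
     (∀ g h : G, lt g h ↔
        ρ h x < ρ g x ∨ ∃ s : stabAt ρ x, h = g * (s : G) ∧ lt' 1 s))

/-! ### The groups `BS(1, q)` -/

/-- The two generators of the presentation. -/
inductive BSGen
  | a
  | b

/-- The defining relator `a b a⁻¹ (b ^ q)⁻¹`. -/
def bsRel (q : ℤ) : FreeGroup BSGen :=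
  FreeGroup.of .a * FreeGroup.of .b * (FreeGroup.of .a)⁻¹ * (FreeGroup.of .b ^ q)⁻¹

/-- The Baumslag–Solitar group `BS(1, q) = ⟨a, b ∣ a b a⁻¹ = b ^ q⟩`. -/
abbrev BS (q : ℤ) : Type := PresentedGroup ({bsRel q} : Set (FreeGroup BSGen))

/-- The images of the generators under the affine action: `a : x ↦ q x` and `b : x ↦ x + 1`. -/
noncomputable def bsAffineGen (q : ℤ) (hq : 0 < q) : BSGen → (ℝ ≃o ℝ)
  | .a => OrderIso.mulLeft₀ (q : ℝ) (Int.cast_pos.mpr hq)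
  | .b => OrderIso.addRight (1 : ℝ)

theorem addRight_one_zpow_apply (n : ℤ) (x : ℝ) :
    ((OrderIso.addRight (1 : ℝ)) ^ n) x = x + n := by
  induction n using Int.induction_on generalizing x with
  | zero => simp
  | succ k ih =>
    rw [zpow_add, RelIso.mul_apply, ih, zpow_one]
    simp only [OrderIso.addRight_apply]
    push_cast
    ring
  | pred k ih =>
    have h : ((OrderIso.addRight (1 : ℝ))⁻¹ : ℝ ≃o ℝ) x = x - 1 := by
      change (OrderIso.addRight (1 : ℝ)).symm x = x - 1
      simp [sub_eq_add_neg]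
    rw [zpow_sub, zpow_one, RelIso.mul_apply, h, ih]
    push_cast
    ring

theorem bsAffineGen_rel (q : ℤ) (hq : 0 < q) :
    ∀ r ∈ ({bsRel q} : Set (FreeGroup BSGen)), FreeGroup.lift (bsAffineGen q hq) r = 1 := by
  intro r hr
  rw [Set.mem_singleton_iff] at hr
  subst hr
  simp only [bsRel, map_mul, map_inv, map_zpow, FreeGroup.lift_apply_of, bsAffineGen]
  rw [mul_inv_eq_one, mul_inv_eq_iff_eq_mul]
  ext x
  rw [RelIso.mul_apply, RelIso.mul_apply, addRight_one_zpow_apply]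
  simp only [OrderIso.mulLeft₀_apply, OrderIso.addRight_apply]
  ring

/-- The affine action of `BS(1, q)` on the real line, for `q > 0`, determined by
`a : x ↦ q x` and `b : x ↦ x + 1`. -/
noncomputable def bsAffine (q : ℤ) (hq : 0 < q) : BS q →* (ℝ ≃o ℝ) :=
  PresentedGroup.toGroup (bsAffineGen_rel q hq)

/-! ### Left-orders and their positive cones -/

section LeftOrder

variable {G : Type*} [Group G]

/-! For `q ≠ 0` an element is determined by its height and the translation part of its affine map
(`ext_ht_trans`), and the kernel K of the height is a copy of ℤ[1/q]. Each element of K has a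
positive power in ⟨b⟩, so after a possible reversal making b positive, any left-order restricts to K
as the usual order of translation parts (`lt_iff_trans_lt`).

By `sign_or_cofinal_ker`, either the sign of the height decides the order up to orientation, or K is
cofinal in both directions. Cofinality forces `0 < q` (`pos_of_cofinal`). For `q ≥ 2`, the positions
of the powers of a among K then form a cocycle (`cut_add`). This cocycle is a coboundary because ℤ
is abelian, which produces the base point of the affine action.

The first alternative is never regular when `|q| ≥ 2` (`not_isRegularLeftOrder_of_sign`): finitely
many left quotients bound from below the heights of prefixes of accepted words of height zero, so
the denominators in K would be bounded. Hence no order is regular for `q ≤ -2`, and for `q ≥ 2` only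
affine ones can be.

Existence for `q ≥ -1` comes from explicit rational expressions for positive cones. For `q ≤ -2` the
cone in which height dominates is accepted with one counter: it records the depth of a descent, so
that the return to height zero can be recognised. Descending by a⁻² keeps the powers of q positive.
-/

theorem isLeftOrder_of_posCone (P : Set G) (hmul : ∀ g ∈ P, ∀ h ∈ P, g * h ∈ P)
    (hone : (1 : G) ∉ P) (htri : ∀ g : G, g ≠ 1 → g ∈ P ∨ g⁻¹ ∈ P) :
    IsLeftOrder (fun g h : G => g⁻¹ * h ∈ P) where
  strictTotal :=
    { trichotomous := fun g h hgh hhg => by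
        by_contra hne
        rcases htri (g⁻¹ * h) (fun h1 => hne (inv_mul_eq_one.mp h1)) with h1 | h1
        · exact hgh h1
        · exact hhg (by simpa using h1)
      irrefl := fun g => by simpa using hone
      trans := fun f g h h1 h2 => by simpa [mul_assoc] using hmul _ h1 _ h2 }
  mul_left_iff := fun f g h => by simp [mul_assoc]

theorem posCone_inv_mul_mem (P : Set G) : posCone (fun g h : G => g⁻¹ * h ∈ P) = P := by
  ext g
  simp [posCone]

namespace IsLeftOrder

variable {lt : G → G → Prop} (H : IsLeftOrder lt)
include H

theorem irrefl (g : G) : ¬ lt g g := H.strictTotal.irrefl g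

theorem trans {f g h : G} (h1 : lt f g) (h2 : lt g h) : lt f h := H.strictTotal.trans f g h h1 h2

theorem asymm {g h : G} (h1 : lt g h) : ¬ lt h g := fun h2 => H.irrefl g (H.trans h1 h2)

theorem eq_or_lt_or_gt (g h : G) : g = h ∨ lt g h ∨ lt h g := by
  by_contra! hc
  exact hc.1 (H.strictTotal.trichotomous g h hc.2.1 hc.2.2)

theorem lt_iff_one_lt (g h : G) : lt g h ↔ lt 1 (g⁻¹ * h) := by
  rw [← H.mul_left_iff g⁻¹ g h, inv_mul_cancel]

theorem lt_one_iff (g : G) : lt g 1 ↔ lt 1 g⁻¹ := by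
  rw [H.lt_iff_one_lt, mul_one]

theorem one_lt_mul {g h : G} (hg : lt 1 g) (hh : lt 1 h) : lt 1 (g * h) := by
  refine H.trans hg ?_
  rwa [H.lt_iff_one_lt, inv_mul_cancel_left]

theorem one_lt_pow {g : G} (hg : lt 1 g) {n : ℕ} (hn : n ≠ 0) : lt 1 (g ^ n) := by
  obtain ⟨n, rfl⟩ := Nat.exists_eq_succ_of_ne_zero hn
  induction n with
  | zero => simpa using hg
  | succ k ih =>
    rw [pow_succ]
    exact H.one_lt_mul (ih (by omega)) hg

theorem one_lt_of_one_lt_pow {g : G} {n : ℕ} (hg : lt 1 (g ^ n)) : lt 1 g := by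
  rcases H.eq_or_lt_or_gt 1 g with h | h | h
  · subst h
    exact absurd hg (by simpa using H.irrefl 1)
  · exact h
  · rw [H.lt_one_iff] at h
    rcases eq_or_ne n 0 with rfl | hn
    · exact absurd hg (by simpa using H.irrefl 1)
    · have := H.one_lt_mul (H.one_lt_pow h hn) hg
      rw [inv_pow, inv_mul_cancel] at this
      exact absurd this (H.irrefl 1)

theorem swap : IsLeftOrder (fun g h => lt h g) where
  strictTotal :=
    { trichotomous := fun g h h1 h2 => H.strictTotal.trichotomous g h h2 h1
      irrefl := H.irrefl
      trans := fun _ _ _ h1 h2 => H.trans h2 h1 }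
  mul_left_iff := fun f g h => H.mul_left_iff f h g

theorem restrict (K : Subgroup G) : IsLeftOrder (fun g h : K => lt g h) where
  strictTotal :=
    { trichotomous := fun g h h1 h2 => Subtype.ext (H.strictTotal.trichotomous g h h1 h2)
      irrefl := fun g => H.irrefl g
      trans := fun _ _ _ h1 h2 => H.trans h1 h2 }
  mul_left_iff := fun f g h => by simpa using H.mul_left_iff f g h

/-- Given a homomorphism to `ℤ`, either its kernel is convex, so that the sign of the image
decides the order up to orientation, or the kernel is cofinal in both directions. -/
theorem sign_or_cofinal_ker (φ : G →* Multiplicative ℤ) {b : G} (hb : φ b = 1) (hb1 : lt 1 b) :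
    (∃ ε : ℤ, (ε = 1 ∨ ε = -1) ∧ ∀ g, 0 < ε * (φ g).toAdd → lt 1 g) ∨
      ∀ g, (∃ s, φ s = 1 ∧ lt s g) ∧ ∃ s, φ s = 1 ∧ lt g s := by
  -- A single element above the whole kernel suffices: all its positive powers lie above the kernel
  -- too, and they dominate everything modulo the kernel.
  have key : ∀ g, (∀ s, φ s = 1 → lt s g) →
      ∃ ε : ℤ, (ε = 1 ∨ ε = -1) ∧ ∀ g, 0 < ε * (φ g).toAdd → lt 1 g := by
    intro g hg
    have hpow : ∀ n : ℕ, ∀ s, φ s = 1 → lt s (g ^ (n + 1)) := by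
      intro n
      induction n with
      | zero => simpa using hg
      | succ n ih =>
        intro s hs
        refine H.trans (ih s hs) ?_
        rw [H.lt_iff_one_lt, pow_succ g (n + 1), inv_mul_cancel_left]
        exact hg 1 (map_one φ)
    have hne : (φ g).toAdd ≠ 0 := fun h0 => H.irrefl g (hg g h0)
    have main : ∀ h, 0 < (φ g).toAdd * (φ h).toAdd → lt 1 h := by
      intro h hh
      have hne' : (φ h).toAdd ≠ 0 := by
        rintro h0
        simp [h0] at hh
      -- With these exponents `h ^ N` and `g ^ M` have equal image, so they differ by a kernel
      -- element, which lies below `g ^ M`.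
      set N := (φ g).toAdd.natAbs with hN
      set M := (φ h).toAdd.natAbs with hM
      have hker : φ (h ^ N * (g ^ M)⁻¹) = 1 := by
        apply Multiplicative.toAdd.injective
        simp only [map_mul, map_inv, map_pow, toAdd_mul, toAdd_inv, toAdd_pow, toAdd_one,
          nsmul_eq_mul, hN, hM, Int.natCast_natAbs]
        rcases lt_or_gt_of_ne hne with h1 | h1
        · have h2 : (φ h).toAdd < 0 := by nlinarith
          rw [abs_of_neg h1, abs_of_neg h2]; ring
        · have h2 : 0 < (φ h).toAdd := by nlinarith
          rw [abs_of_pos h1, abs_of_pos h2]; ring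
      obtain ⟨m, hm⟩ : ∃ m, M = m + 1 := Nat.exists_eq_succ_of_ne_zero (by simpa [hM] using hne')
      have := hpow m (h ^ N * (g ^ M)⁻¹)⁻¹ (by rw [map_inv, hker, inv_one])
      rw [H.lt_iff_one_lt, inv_inv, ← hm, inv_mul_cancel_right] at this
      exact H.one_lt_of_one_lt_pow this
    rcases lt_or_gt_of_ne hne with h1 | h1
    · exact ⟨-1, Or.inr rfl, fun h hh => main h (by nlinarith)⟩
    · exact ⟨1, Or.inl rfl, fun h hh => main h (by nlinarith)⟩
  rw [or_iff_not_imp_left]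
  intro hc
  have habove : ∀ g, ∃ s, φ s = 1 ∧ lt g s := by
    intro g
    by_contra! hn
    refine hc (key g fun s hs => ?_)
    -- Passing from `s` to `s * b` turns "g is not below any kernel element" into a strict bound.
    have h1 : lt s (s * b) := by rwa [H.lt_iff_one_lt, inv_mul_cancel_left]
    rcases H.eq_or_lt_or_gt g (s * b) with h | h | h
    · rwa [h]
    · exact absurd h (hn _ (by rw [map_mul, hs, hb, one_mul]))
    · exact H.trans h1 h
  refine fun g => ⟨?_, habove g⟩
  -- Lower bounds come from upper bounds of the inverse: g⁻¹ < s says 1 < g s, that is, (g s g⁻¹)⁻¹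
  -- < g, and normality keeps this element in the kernel.
  obtain ⟨s, hs, hlt⟩ := habove g⁻¹
  refine ⟨(g * s * g⁻¹)⁻¹, by simp [hs], ?_⟩
  rw [H.lt_iff_one_lt] at hlt ⊢
  simpa using hlt

end IsLeftOrder

end LeftOrder

/-! ### Height and translation part in `BS(1, q)` -/

namespace BS

variable (q : ℤ)

/-- The generator `a`. -/
def a : BS q := PresentedGroup.of .a

/-- The generator `b`. -/
def b : BS q := PresentedGroup.of .b

theorem a_mul_b : a q * b q = b q ^ q * a q := by
  have h : PresentedGroup.mk {bsRel q} (bsRel q) = 1 := PresentedGroup.one_of_mem rfl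
  exact mul_inv_eq_iff_eq_mul.mp (mul_inv_eq_one.mp h)

theorem a_mul_b_zpow (m : ℤ) : a q * b q ^ m = b q ^ (q * m) * a q := by
  rw [← mul_inv_eq_iff_eq_mul, ← conj_zpow, a_mul_b, mul_inv_cancel_right, zpow_mul]

theorem a_pow_mul_b_zpow (n : ℕ) (m : ℤ) : a q ^ n * b q ^ m = b q ^ (q ^ n * m) * a q ^ n := by
  induction n generalizing m with
  | zero => simp
  | succ n ih =>
    rw [pow_succ, mul_assoc, a_mul_b_zpow, ← mul_assoc, ih, mul_assoc, pow_succ, mul_assoc]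

theorem induction_gen {C : BS q → Prop} (g : BS q) (one : C 1) (mul_a : ∀ g, C g → C (a q * g))
    (mul_a_inv : ∀ g, C g → C ((a q)⁻¹ * g)) (mul_b : ∀ g, C g → C (b q * g))
    (mul_b_inv : ∀ g, C g → C ((b q)⁻¹ * g)) : C g := by
  suffices h : ∀ z : FreeGroup BSGen, ∀ g, C g → C (PresentedGroup.mk {bsRel q} z * g) by
    induction g using PresentedGroup.induction_on with
    | _ z => simpa using h z 1 one
  intro z
  induction z using FreeGroup.induction_on with
  | C1 => simp
  | of x =>
    cases x with
    | a => exact mul_a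
    | b => exact mul_b
  | inv_of x _ =>
    intro g hg
    rw [map_inv]
    cases x with
    | a => exact mul_a_inv g hg
    | b => exact mul_b_inv g hg
  | mul x y hx hy =>
    intro g hg
    rw [map_mul, mul_assoc]
    exact hx _ (hy _ hg)

/-- The set of such products contains 1 and is stable under left multiplication by the generators
and their inverses, since b can be moved past a⁻ⁿ at the cost of the exponent qⁿ. -/
theorem exists_normal_form (g : BS q) :
    ∃ (n : ℕ) (m k : ℤ), g = (a q ^ n)⁻¹ * b q ^ m * a q ^ k := by
  have hb : ∀ (n : ℕ) (j m k : ℤ), b q ^ j * ((a q ^ n)⁻¹ * b q ^ m * a q ^ k) =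
      (a q ^ n)⁻¹ * b q ^ (q ^ n * j + m) * a q ^ k := by
    intro n j m k
    rw [zpow_add, ← mul_assoc, ← mul_assoc, ← mul_assoc]
    congr 2
    rw [eq_inv_mul_iff_mul_eq, ← mul_assoc, a_pow_mul_b_zpow, mul_inv_cancel_right]
  induction g using induction_gen with
  | one => exact ⟨0, 0, 0, by simp⟩
  | mul_a g h =>
    obtain ⟨n, m, k, rfl⟩ := h
    cases n with
    | zero =>
      refine ⟨0, q * m, k + 1, ?_⟩
      rw [pow_zero, inv_one, one_mul, one_mul, ← mul_assoc, a_mul_b_zpow, add_comm k, zpow_add,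
        zpow_one, mul_assoc]
    | succ n =>
      refine ⟨n, m, k, ?_⟩
      rw [pow_succ, mul_inv_rev]
      simp only [← mul_assoc, mul_inv_cancel, one_mul]
  | mul_a_inv g h =>
    obtain ⟨n, m, k, rfl⟩ := h
    exact ⟨n + 1, m, k, by rw [pow_succ, mul_inv_rev]; simp only [mul_assoc]⟩
  | mul_b g h =>
    obtain ⟨n, m, k, rfl⟩ := h
    exact ⟨n, _, k, by simpa using hb n 1 m k⟩
  | mul_b_inv g h =>
    obtain ⟨n, m, k, rfl⟩ := h
    exact ⟨n, _, k, by simpa using hb n (-1) m k⟩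

/-- The height of an element: the total exponent of `a`. -/
def height : BS q →* Multiplicative ℤ :=
  PresentedGroup.toGroup (f := fun x => match x with
    | .a => Multiplicative.ofAdd 1
    | .b => 1) (by
      intro r hr
      rw [Set.mem_singleton_iff] at hr
      subst hr
      simp [bsRel])

variable {q}

/-- The height of an element, as an integer. -/
def ht (g : BS q) : ℤ := (height q g).toAdd

@[simp] theorem ht_one : ht (1 : BS q) = 0 := by simp [ht]

@[simp] theorem ht_mul (g h : BS q) : ht (g * h) = ht g + ht h := by simp [ht]

@[simp] theorem ht_inv (g : BS q) : ht g⁻¹ = -ht g := by simp [ht]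

@[simp] theorem ht_pow (g : BS q) (n : ℕ) : ht (g ^ n) = n * ht g := by simp [ht]

@[simp] theorem ht_zpow (g : BS q) (n : ℤ) : ht (g ^ n) = n * ht g := by simp [ht]

@[simp] theorem ht_a : ht (a q) = 1 := by simp [ht, a, height]

@[simp] theorem ht_b : ht (b q) = 0 := by simp [ht, b, height]

theorem height_eq_one_iff (g : BS q) : height q g = 1 ↔ ht g = 0 := by
  rw [ht, toAdd_eq_zero]

section NeZero

variable [NeZero q]

theorem cast_ne_zero : (q : ℝ) ≠ 0 := Int.cast_ne_zero.mpr (NeZero.ne q)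

omit [NeZero q] in
theorem equivAddRight_one_zpow_apply (n : ℤ) (x : ℝ) :
    ((Equiv.addRight (1 : ℝ) : Equiv.Perm ℝ) ^ n) x = x + n := by
  induction n generalizing x with
  | zero => simp
  | succ k ih =>
    rw [zpow_add_one, Equiv.Perm.mul_apply, ih, Equiv.coe_addRight]
    push_cast
    ring
  | pred k ih =>
    have h : (Equiv.addRight (1 : ℝ) : Equiv.Perm ℝ)⁻¹ x = x - 1 := by
      rw [Equiv.Perm.inv_eq_iff_eq]
      simp
    rw [zpow_sub_one, Equiv.Perm.mul_apply, h, ih]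
    push_cast
    ring

/-- The action of `BS(1, q)` on `ℝ` by affine maps, for `q ≠ 0`. -/
noncomputable def affine (q : ℤ) [NeZero q] : BS q →* Equiv.Perm ℝ :=
  PresentedGroup.toGroup (f := fun x => match x with
    | .a => Equiv.mulLeft₀ (q : ℝ) cast_ne_zero
    | .b => Equiv.addRight (1 : ℝ)) (by
      intro r hr
      rw [Set.mem_singleton_iff] at hr
      subst hr
      simp only [bsRel, map_mul, map_inv, map_zpow, FreeGroup.lift_apply_of]
      rw [mul_inv_eq_one, mul_inv_eq_iff_eq_mul]
      ext x
      rw [Equiv.Perm.mul_apply, Equiv.Perm.mul_apply, equivAddRight_one_zpow_apply]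
      simp
      ring)

/-- The translation part of the affine map given by an element of `BS(1, q)`. -/
noncomputable def trans (g : BS q) : ℝ := affine q g 0

theorem affine_apply (g : BS q) (x : ℝ) : affine q g x = (q : ℝ) ^ ht g * x + trans g := by
  have hq : (q : ℝ) ≠ 0 := cast_ne_zero
  have ha : ∀ x, affine q (a q) x = q * x := fun x => by simp [affine, a]
  have hb : ∀ x, affine q (b q) x = x + 1 := fun x => by simp [affine, b]
  have ha' : ∀ x, affine q (a q)⁻¹ x = (q : ℝ)⁻¹ * x := fun x => by
    rw [map_inv, Equiv.Perm.inv_eq_iff_eq, ha, mul_inv_cancel_left₀ hq]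
  have hb' : ∀ x, affine q (b q)⁻¹ x = x - 1 := fun x => by
    rw [map_inv, Equiv.Perm.inv_eq_iff_eq, hb, sub_add_cancel]
  unfold trans
  induction g using induction_gen generalizing x with
  | one => simp
  | mul_a g h =>
    rw [map_mul, Equiv.Perm.mul_apply, Equiv.Perm.mul_apply, h, ha, ha, ht_mul, zpow_add₀ hq, ht_a,
      zpow_one]
    ring
  | mul_a_inv g h =>
    rw [map_mul, Equiv.Perm.mul_apply, Equiv.Perm.mul_apply, h, ha', ha', ht_mul, zpow_add₀ hq,
      ht_inv, ht_a, zpow_neg_one]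
    ring
  | mul_b g h =>
    rw [map_mul, Equiv.Perm.mul_apply, Equiv.Perm.mul_apply, h, hb, hb, ht_mul, ht_b, zero_add]
    ring
  | mul_b_inv g h =>
    rw [map_mul, Equiv.Perm.mul_apply, Equiv.Perm.mul_apply, h, hb', hb', ht_mul, ht_inv, ht_b,
      neg_zero, zero_add]
    ring

@[simp] theorem trans_one : trans (1 : BS q) = 0 := by simp [trans]

@[simp] theorem trans_a : trans (a q) = 0 := by simp [trans, affine, a]

@[simp] theorem trans_b : trans (b q) = 1 := by simp [trans, affine, b]

theorem trans_mul (g h : BS q) : trans (g * h) = trans g + (q : ℝ) ^ ht g * trans h := by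
  rw [trans, map_mul, Equiv.Perm.mul_apply, affine_apply, add_comm]
  rfl

theorem trans_inv (g : BS q) : trans g⁻¹ = -((q : ℝ) ^ (-ht g) * trans g) := by
  have h := trans_mul g⁻¹ g
  rw [inv_mul_cancel, trans_one, ht_inv] at h
  linarith

theorem trans_a_zpow (k : ℤ) : trans (a q ^ k) = 0 := by
  induction k with
  | zero => simp
  | succ k ih => rw [zpow_add_one, trans_mul, ih]; simp
  | pred k ih => rw [zpow_sub_one, trans_mul, ih, trans_inv]; simp

theorem trans_a_pow (k : ℕ) : trans (a q ^ k) = 0 := by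
  simpa using trans_a_zpow (q := q) k

theorem trans_b_zpow (m : ℤ) : trans (b q ^ m) = m := by
  induction m with
  | zero => simp
  | succ k ih => rw [zpow_add_one, trans_mul, ih]; simp
  | pred k ih => rw [zpow_sub_one, trans_mul, ih, trans_inv]; simp; ring

theorem trans_pow_of_ht_eq_zero {s : BS q} (hs : ht s = 0) (n : ℕ) :
    trans (s ^ n) = n * trans s := by
  induction n with
  | zero => simp
  | succ n ih => rw [pow_succ, trans_mul, ih]; simp [hs]; ring

theorem trans_normal_form (n : ℕ) (m k : ℤ) :
    trans ((a q ^ n)⁻¹ * b q ^ m * a q ^ k) = (q : ℝ) ^ (-(n : ℤ)) * m := by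
  rw [trans_mul, trans_mul, trans_inv, trans_a_pow, trans_a_zpow, trans_b_zpow]
  simp

omit [NeZero q] in
theorem ht_normal_form (n : ℕ) (m k : ℤ) :
    ht ((a q ^ n)⁻¹ * b q ^ m * a q ^ k) = k - n := by
  simp; ring

theorem eq_one_of_ht_of_trans {g : BS q} (h1 : ht g = 0) (h2 : trans g = 0) : g = 1 := by
  obtain ⟨n, m, k, rfl⟩ := exists_normal_form q g
  rw [ht_normal_form, sub_eq_zero] at h1
  rw [trans_normal_form, mul_eq_zero, or_iff_right (zpow_ne_zero _ cast_ne_zero),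
    Int.cast_eq_zero] at h2
  simp [h1, h2]

/-- Faithfulness of the affine action. Identities in the group are checked below on these two
coordinates. -/
theorem ext_ht_trans {g h : BS q} (h1 : ht g = ht h) (h2 : trans g = trans h) : g = h := by
  refine inv_mul_eq_one.mp (eq_one_of_ht_of_trans (by simp [h1]) ?_)
  rw [trans_mul, trans_inv, ht_inv, h1, h2]
  ring

/-- Every element has translation part in `ℤ[1/q]`. -/
theorem exists_trans_eq (g : BS q) : ∃ (n : ℕ) (m : ℤ), trans g = (q : ℝ) ^ (-(n : ℤ)) * m := by
  obtain ⟨n, m, k, rfl⟩ := exists_normal_form q g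
  exact ⟨n, m, trans_normal_form n m k⟩

theorem bsAffine_apply (hq : 0 < q) (g : BS q) (x : ℝ) :
    bsAffine q hq g x = (q : ℝ) ^ ht g * x + trans g := by
  rw [← affine_apply]
  -- Forgetting the order lets the two actions be compared on generators.
  let F : (ℝ ≃o ℝ) →* Equiv.Perm ℝ :=
    { toFun := fun e => e.toEquiv
      map_one' := rfl
      map_mul' := fun _ _ => rfl }
  have h : F.comp (bsAffine q hq) = affine q := PresentedGroup.ext fun y => by
    cases y <;> ext x <;> simp [bsAffine, bsAffineGen, affine] <;> rfl
  exact DFunLike.congr_fun (DFunLike.congr_fun h g) x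

end NeZero

end BS

/-! ### Closure properties of regular languages -/

namespace Language

variable {X : Type*}

theorem IsRegular.singleton (w : List X) : IsRegular ({w} : Language X) := by
  rw [isRegular_iff_finite_range_leftQuotient]
  refine ((w.tails.finite_toSet.image fun v => ({v} : Language X)).insert 0).subset ?_
  rintro _ ⟨u, rfl⟩
  by_cases h : u <+: w
  · obtain ⟨v, rfl⟩ := h
    refine Or.inr ⟨v, by simp, ?_⟩
    ext y
    exact (List.append_right_inj (t₁ := y) (t₂ := v) u).symm
  · refine Or.inl (Language.ext fun y => ⟨fun hy => h ⟨y, hy⟩, fun hy => hy.elim⟩)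

/-- By Myhill–Nerode: the quotient of `L * M` by u is (u⁻¹L)M together with the quotients y⁻¹M over
splittings u = xy with x ∈ L. Only finitely many languages arise this way. -/
theorem IsRegular.mul {L M : Language X} (hL : L.IsRegular) (hM : M.IsRegular) :
    (L * M).IsRegular := by
  rw [isRegular_iff_finite_range_leftQuotient] at *
  let F : Language X × Set (Language X) → Language X := fun p => p.1 * M + ⨆ T ∈ p.2, T
  refine ((hL.prod hM.finite_subsets).image F).subset ?_
  rintro _ ⟨u, rfl⟩
  refine ⟨(L.leftQuotient u, {T | ∃ x y, x ∈ L ∧ x ++ y = u ∧ M.leftQuotient y = T}),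
    ⟨⟨u, rfl⟩, ?_⟩, ?_⟩
  · rintro _ ⟨x, y, -, -, rfl⟩
    exact ⟨y, rfl⟩
  · ext v
    simp only [F, mem_add, mem_mul, mem_iSup, mem_leftQuotient, Set.mem_ofPred_eq]
    constructor
    · rintro (⟨x, hx, y, hy, rfl⟩ | ⟨_, ⟨x, y, hx, rfl, rfl⟩, hv⟩)
      · exact ⟨u ++ x, hx, y, hy, by simp⟩
      · exact ⟨x, hx, y ++ v, hv, by simp⟩
    · rintro ⟨x, hx, y, hy, h⟩
      rcases List.append_eq_append_iff.mp h with ⟨z, rfl, rfl⟩ | ⟨z, rfl, rfl⟩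
      · exact Or.inr ⟨_, ⟨x, z, hx, rfl, rfl⟩, hy⟩
      · exact Or.inl ⟨z, hx, y, hy, rfl⟩

/-- The cut between `u` and `v` falls inside or at the boundary of some factor `y ++ z`. For empty
`u` there might be no factor at all. -/
theorem append_mem_kstar_iff {L : Language X} {u v : List X} (hu : u ≠ []) :
    u ++ v ∈ KStar.kstar L ↔ ∃ x y z t, x ∈ KStar.kstar L ∧ t ∈ KStar.kstar L ∧
      u = x ++ y ∧ v = z ++ t ∧ y ++ z ∈ L := by
  constructor
  · rintro ⟨W, hW, hWL⟩
    induction W generalizing u with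
    | nil => simp at hW; exact absurd hW.1 hu
    | cons w W ih =>
      rw [List.flatten_cons] at hW
      rcases List.append_eq_append_iff.mp hW with ⟨z, rfl, rfl⟩ | ⟨y, rfl, h⟩
      · exact ⟨[], u, z, _, nil_mem_kstar L,
          join_mem_kstar fun y hy => hWL y (List.mem_cons_of_mem _ hy), rfl, rfl,
          hWL _ List.mem_cons_self⟩
      · rcases eq_or_ne y [] with rfl | hy
        · refine ⟨[], w, [], v, nil_mem_kstar L, ?_, by simp, rfl,
            by simpa using hWL _ List.mem_cons_self⟩
          rw [List.nil_append] at h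
          rw [← h]
          exact join_mem_kstar fun y hy => hWL y (List.mem_cons_of_mem _ hy)
        · obtain ⟨x, y', z, t, hx, ht, rfl, rfl, hyz⟩ :=
            ih hy h.symm fun y hy => hWL y (List.mem_cons_of_mem _ hy)
          refine ⟨w ++ x, y', z, t, ?_, ht, by simp, rfl, hyz⟩
          obtain ⟨V, rfl, hV⟩ := hx
          refine ⟨w :: V, by simp, ?_⟩
          rintro y (_ | ⟨_, hy⟩)
          · exact hWL _ List.mem_cons_self
          · exact hV _ (by assumption)
  · rintro ⟨x, y, z, t, ⟨V, rfl, hV⟩, ⟨W, rfl, hW⟩, rfl, rfl, h⟩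
    refine ⟨V ++ (y ++ z) :: W, by simp, ?_⟩
    simp only [List.mem_append, List.mem_cons]
    rintro w (hw | rfl | hw)
    exacts [hV w hw, h, hW w hw]

theorem IsRegular.kstar {L : Language X} (hL : L.IsRegular) : (KStar.kstar L).IsRegular := by
  rw [isRegular_iff_finite_range_leftQuotient] at *
  let F : Set (Language X) → Language X := fun S => (⨆ T ∈ S, T) * KStar.kstar L
  refine ((hL.finite_subsets.image F).insert (KStar.kstar L)).subset ?_
  rintro _ ⟨u, rfl⟩
  rcases eq_or_ne u [] with rfl | hu
  · exact Or.inl rfl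
  refine Or.inr ⟨{T | ∃ x y, x ∈ KStar.kstar L ∧ u = x ++ y ∧ L.leftQuotient y = T}, ?_, ?_⟩
  · rintro _ ⟨x, y, -, -, rfl⟩
    exact ⟨y, rfl⟩
  · ext v
    simp only [F, mem_mul, mem_iSup, mem_leftQuotient, Set.mem_ofPred_eq,
      append_mem_kstar_iff hu]
    constructor
    · rintro ⟨z, ⟨_, ⟨x, y, hx, rfl, rfl⟩, hz⟩, t, ht, rfl⟩
      exact ⟨x, y, z, t, hx, ht, rfl, rfl, hz⟩
    · rintro ⟨x, y, z, t, hx, ht, rfl, rfl, h⟩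
      exact ⟨z, ⟨_, ⟨x, y, hx, rfl, rfl⟩, h⟩, t, ht, rfl⟩

/-- Prefixes of words of a regular language have completions from a finite set. -/
theorem IsRegular.exists_finite_suffixes {L : Language X} (hL : L.IsRegular) :
    ∃ V : Set (List X), V.Finite ∧ ∀ u v, u ++ v ∈ L → ∃ v' ∈ V, u ++ v' ∈ L := by
  classical
  -- One chosen word per nonempty left quotient; the default `[]` only serves the empty quotient.
  refine ⟨(fun T : Language X => if h : ∃ v, v ∈ T then h.choose else []) ''
    Set.range L.leftQuotient, hL.finite_range_leftQuotient.image _, fun u v h => ?_⟩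
  have h' : ∃ v, v ∈ L.leftQuotient u := ⟨v, h⟩
  refine ⟨_, ⟨_, ⟨u, rfl⟩, rfl⟩, ?_⟩
  simp only [dif_pos h']
  exact h'.choose_spec

/-- The prefixes of words of a regular language can be replaced by prefixes from a finite set. -/
theorem IsRegular.exists_finite_prefixes {L : Language X} (hL : L.IsRegular) :
    ∃ U : Set (List X), U.Finite ∧ ∀ u v, u ++ v ∈ L → ∃ u' ∈ U, u' ++ v ∈ L := by
  obtain ⟨U, -, hfin, hU⟩ := Set.Finite.exists_subset_finite_image_eq
    hL.finite_range_leftQuotient Set.image_univ.ge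
  refine ⟨U, hfin, fun u v h => ?_⟩
  obtain ⟨u', hu', he⟩ := hU.ge ⟨u, rfl⟩
  exact ⟨u', hu', (congrArg (v ∈ ·) he).mpr h⟩

end Language

/-! ### Subsets of a group represented by regular languages -/

section Represented

variable {X G : Type*} [Group G] {π : FreeMonoid X →* G} {S T : Set G}

open scoped Pointwise

theorem pow_mem_closure_self (g : G) (n : ℕ) : g ^ n ∈ (Submonoid.closure {g} : Set G) :=
  Submonoid.mem_closure_singleton.mpr ⟨n, rfl⟩

theorem isRepresentedBy_regular_singleton (hπ : Function.Surjective π) (g : G) :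
    IsRepresentedBy Language.IsRegular π {g} := by
  obtain ⟨w, rfl⟩ := hπ g
  refine ⟨_, Language.IsRegular.singleton w.toList, ?_⟩
  ext g
  constructor
  · rintro ⟨_, rfl, rfl⟩
    rfl
  · rintro rfl
    exact ⟨_, rfl, rfl⟩

theorem IsRepresentedBy.union_regular (hS : IsRepresentedBy Language.IsRegular π S)
    (hT : IsRepresentedBy Language.IsRegular π T) :
    IsRepresentedBy Language.IsRegular π (S ∪ T) := by
  obtain ⟨L, hL, rfl⟩ := hS
  obtain ⟨M, hM, rfl⟩ := hT
  refine ⟨L + M, hL.add hM, ?_⟩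
  ext g
  simp only [Language.mem_add, Set.mem_ofPred_eq, Set.mem_union, or_and_right, exists_or]

theorem IsRepresentedBy.mul_regular (hS : IsRepresentedBy Language.IsRegular π S)
    (hT : IsRepresentedBy Language.IsRegular π T) :
    IsRepresentedBy Language.IsRegular π (S * T) := by
  obtain ⟨L, hL, rfl⟩ := hS
  obtain ⟨M, hM, rfl⟩ := hT
  refine ⟨L * M, hL.mul hM, ?_⟩
  ext g
  simp only [Language.mem_mul, Set.mem_mul, Set.mem_ofPred_eq]
  constructor
  · rintro ⟨_, ⟨x, hx, y, hy, rfl⟩, rfl⟩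
    exact ⟨_, ⟨x, hx, rfl⟩, _, ⟨y, hy, rfl⟩, by rw [FreeMonoid.ofList_append, map_mul]⟩
  · rintro ⟨_, ⟨x, hx, rfl⟩, _, ⟨y, hy, rfl⟩, rfl⟩
    exact ⟨_, ⟨x, hx, y, hy, rfl⟩, by rw [FreeMonoid.ofList_append, map_mul]⟩

theorem IsRepresentedBy.closure_regular (hS : IsRepresentedBy Language.IsRegular π S) :
    IsRepresentedBy Language.IsRegular π (Submonoid.closure S : Set G) := by
  obtain ⟨L, hL, rfl⟩ := hS
  refine ⟨KStar.kstar L, hL.kstar, ?_⟩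
  ext g
  constructor
  · rintro ⟨_, ⟨W, rfl, hW⟩, rfl⟩
    induction W with
    | nil =>
      rw [List.flatten_nil, FreeMonoid.ofList_nil, map_one]
      exact (Submonoid.closure _).one_mem
    | cons w W ih =>
      rw [List.flatten_cons, FreeMonoid.ofList_append, map_mul]
      exact mul_mem (Submonoid.subset_closure ⟨w, hW w List.mem_cons_self, rfl⟩)
        (ih fun y hy => hW y (List.mem_cons_of_mem _ hy))
  · intro hg
    induction hg using Submonoid.closure_induction with
    | mem g h =>
      obtain ⟨w, hw, rfl⟩ := h
      exact ⟨w, ⟨[w], by simp, by simpa using hw⟩, rfl⟩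
    | one => exact ⟨[], Language.nil_mem_kstar L, map_one π⟩
    | mul g h _ _ ihg ihh =>
      obtain ⟨_, ⟨V, rfl, hV⟩, rfl⟩ := ihg
      obtain ⟨_, ⟨W, rfl, hW⟩, rfl⟩ := ihh
      refine ⟨_, ⟨V ++ W, rfl, ?_⟩, by rw [List.flatten_append, FreeMonoid.ofList_append, map_mul]⟩
      simp only [List.mem_append]
      rintro y (hy | hy)
      exacts [hV y hy, hW y hy]

end Represented

/-! ### Regular left-orders on `BS(1, q)` for `q ≥ -1` -/

namespace BS

variable {q : ℤ}

open scoped Pointwise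

/-- The positive cone of the left-order in which the translation part dominates. -/
def transCone (q : ℤ) [NeZero q] : Set (BS q) := {g | 0 < trans g ∨ trans g = 0 ∧ 0 < ht g}

/-- The positive cone of the left-order in which the height dominates. -/
def heightCone (q : ℤ) [NeZero q] : Set (BS q) := {g | 0 < ht g ∨ ht g = 0 ∧ 0 < trans g}

theorem isLeftOrder_transCone [NeZero q] (hq : 0 < q) :
    IsLeftOrder (fun g h : BS q => g⁻¹ * h ∈ transCone q) := by
  have hpos : ∀ n : ℤ, 0 < (q : ℝ) ^ n := fun n => zpow_pos (Int.cast_pos.mpr hq) n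
  refine isLeftOrder_of_posCone _ ?_ (by simp [transCone]) fun g hg => ?_
  · rintro g hg h hh
    have h1 := hpos (ht g)
    simp only [transCone, Set.mem_ofPred_eq, trans_mul, ht_mul] at *
    rcases hg with hg | ⟨hg, hg'⟩ <;> rcases hh with hh | ⟨hh, hh'⟩
    · left; positivity
    · left; simpa [hh] using hg
    · left; rw [hg, zero_add]; positivity
    · right; rw [hg, hh]; exact ⟨by simp, by omega⟩
  · have h1 := hpos (-ht g)
    simp only [transCone, Set.mem_ofPred_eq, trans_inv, ht_inv]
    rcases lt_trichotomy (trans g) 0 with h | h | h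
    · right; left; rw [neg_pos]; exact mul_neg_of_pos_of_neg h1 h
    · have : ht g ≠ 0 := fun h0 => hg (eq_one_of_ht_of_trans h0 h)
      rcases lt_or_gt_of_ne this with h' | h'
      · right; right; exact ⟨by simp [h], by omega⟩
      · exact Or.inl (Or.inr ⟨h, h'⟩)
    · exact Or.inl (Or.inl h)

theorem isLeftOrder_heightCone [NeZero q] :
    IsLeftOrder (fun g h : BS q => g⁻¹ * h ∈ heightCone q) := by
  refine isLeftOrder_of_posCone _ ?_ (by simp [heightCone]) fun g hg => ?_
  · rintro g hg h hh
    simp only [heightCone, Set.mem_ofPred_eq, trans_mul, ht_mul] at *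
    rcases hg with hg | ⟨hg, hg'⟩ <;> rcases hh with hh | ⟨hh, hh'⟩
    · left; omega
    · left; omega
    · left; omega
    · right; rw [hg, hh]; exact ⟨by simp, by simpa using add_pos hg' hh'⟩
  · simp only [heightCone, Set.mem_ofPred_eq, trans_inv, ht_inv]
    rcases lt_trichotomy (ht g) 0 with h | h | h
    · right; left; omega
    · have : trans g ≠ 0 := fun h0 => hg (eq_one_of_ht_of_trans h h0)
      rcases lt_or_gt_of_ne this with h' | h'
      · right; right; exact ⟨by simp [h], by simpa [h] using h'⟩
      · exact Or.inl (Or.inr ⟨h, h'⟩)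
    · exact Or.inl (Or.inl h)

/-- For positive q, words in a, a⁻¹ and b never have negative translation part, and one leading b
makes it positive. Conversely, the normal form of an element with positive translation has
b-exponent at least one. -/
theorem transCone_eq [NeZero q] (hq : 0 < q) : transCone q =
    (Submonoid.closure {(a q)⁻¹} : Set (BS q)) * {b q} *
      (Submonoid.closure ({a q} ∪ {(a q)⁻¹} ∪ {b q}) : Set (BS q)) ∪
    {a q} * (Submonoid.closure {a q} : Set (BS q)) := by
  have hpos : ∀ n : ℤ, 0 < (q : ℝ) ^ n := fun n => zpow_pos (Int.cast_pos.mpr hq) n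
  ext g
  constructor
  · rintro (h | ⟨h0, h1⟩)
    · obtain ⟨n, m, k, rfl⟩ := exists_normal_form q g
      rw [trans_normal_form, mul_pos_iff_of_pos_left (hpos _), Int.cast_pos] at h
      obtain ⟨m, rfl⟩ : ∃ j : ℕ, m = j + 1 := ⟨(m - 1).toNat, by omega⟩
      have hc : ({a q} ∪ {(a q)⁻¹} ∪ {b q} : Set (BS q)) ⊆
          Submonoid.closure ({a q} ∪ {(a q)⁻¹} ∪ {b q}) := Submonoid.subset_closure
      have ha : a q ^ k ∈ Submonoid.closure ({a q} ∪ {(a q)⁻¹} ∪ {b q} : Set (BS q)) := by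
        rcases k.eq_nat_or_neg with ⟨k, rfl | rfl⟩
        · rw [zpow_natCast]
          exact pow_mem (hc (Or.inl (Or.inl rfl))) k
        · rw [zpow_neg, zpow_natCast, ← inv_pow]
          exact pow_mem (hc (Or.inl (Or.inr rfl))) k
      have hn := pow_mem_closure_self (a q)⁻¹ n
      refine Or.inl (Set.mem_mul.mpr ⟨(a q)⁻¹ ^ n * b q, Set.mul_mem_mul hn rfl, b q ^ m * a q ^ k,
        mul_mem (pow_mem (hc (Or.inr rfl)) m) ha, ?_⟩)
      rw [add_comm, zpow_add, zpow_one, zpow_natCast, inv_pow]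
      simp only [mul_assoc]
    · refine Or.inr ⟨a q, rfl, a q ^ (ht g - 1).toNat,
        pow_mem_closure_self _ _, ?_⟩
      refine ext_ht_trans ?_ ?_
      · simp; omega
      · simp [trans_mul, trans_a_pow, h0]
  · rintro (⟨_, ⟨x, hx, _, rfl, rfl⟩, y, hy, rfl⟩ | ⟨_, rfl, y, hy, rfl⟩)
    · obtain ⟨n, rfl⟩ := Submonoid.mem_closure_singleton.mp hx
      have h0 : 0 ≤ trans y := by
        induction hy using Submonoid.closure_induction with
        | mem y h =>
          rcases h with (rfl | rfl) | rfl <;> simp [trans_inv]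
        | one => simp
        | mul x y _ _ hx hy =>
          rw [trans_mul]
          have := hpos (ht x)
          positivity
      left
      simp only [trans_mul, inv_pow, trans_inv, trans_a_pow]
      have := hpos (ht (a q ^ n)⁻¹)
      have := hpos (ht ((a q ^ n)⁻¹ * b q))
      rw [trans_b]
      simp only [mul_zero, neg_zero, zero_add, mul_one]
      positivity
    · obtain ⟨n, rfl⟩ := Submonoid.mem_closure_singleton.mp hy
      right
      simp [trans_mul, trans_a_pow]
      omega

instance : NeZero (-1 : ℤ) := ⟨by decide⟩

/-- For `q = -1` all translation parts are integers, so the kernel of the height is just ⟨b⟩. -/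
theorem heightCone_neg_one_eq : heightCone (-1) =
    {b (-1)} * (Submonoid.closure {b (-1)} : Set (BS (-1))) ∪
    (Submonoid.closure ({b (-1)} ∪ {(b (-1))⁻¹}) : Set (BS (-1))) *
      ({a (-1)} * (Submonoid.closure {a (-1)} : Set (BS (-1)))) := by
  have hint : ∀ g : BS (-1), ∃ m : ℤ, trans g = m := by
    intro g
    obtain ⟨n, m, h⟩ := exists_trans_eq g
    rcases Int.even_or_odd (-(n : ℤ)) with h1 | h1
    · exact ⟨m, by rw [h]; simp [h1.neg_one_zpow]⟩
    · exact ⟨-m, by rw [h]; simp [h1.neg_one_zpow]⟩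
  ext g
  constructor
  · obtain ⟨m, hm⟩ := hint g
    rintro (h | ⟨h0, h1⟩)
    · refine Or.inr ⟨b _ ^ m, ?_, _, ⟨a _, rfl, a _ ^ (ht g - 1).toNat,
        pow_mem_closure_self _ _, rfl⟩, ?_⟩
      · rcases m.eq_nat_or_neg with ⟨k, rfl | rfl⟩
        · rw [zpow_natCast]
          exact pow_mem (Submonoid.subset_closure (by simp)) k
        · rw [zpow_neg, zpow_natCast, ← inv_pow]
          exact pow_mem (Submonoid.subset_closure (by simp)) k
      · refine ext_ht_trans ?_ ?_
        · simp; omega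
        · simp [trans_mul, trans_b_zpow, trans_a_pow, hm]
    · rw [hm, Int.cast_pos] at h1
      refine Or.inl ⟨b _, rfl, b _ ^ (m - 1).toNat, pow_mem_closure_self _ _, ?_⟩
      have h2 : b (-1) * b (-1) ^ (m - 1).toNat = b (-1) ^ m := by
        rw [← zpow_natCast, ← zpow_one_add]
        congr 1
        omega
      refine (h2.trans (ext_ht_trans ?_ ?_) : _)
      · simp [h0]
      · rw [trans_b_zpow, hm]
  · rintro (⟨_, rfl, y, hy, rfl⟩ | ⟨x, hx, _, ⟨_, rfl, y, hy, rfl⟩, rfl⟩)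
    · obtain ⟨n, rfl⟩ := Submonoid.mem_closure_singleton.mp hy
      right
      rw [trans_mul, trans_pow_of_ht_eq_zero ht_b]
      simp
      positivity
    · obtain ⟨n, rfl⟩ := Submonoid.mem_closure_singleton.mp hy
      have h0 : ht x = 0 := by
        induction hx using Submonoid.closure_induction with
        | mem y h => rcases h with rfl | rfl <;> simp
        | one => simp
        | mul x y _ _ hx hy => simp [hx, hy]
      left
      simp [h0]
      omega

theorem b_zero_eq_one : b 0 = 1 := by
  have h := a_mul_b 0
  rw [zpow_zero, one_mul] at h
  exact mul_eq_left.mp h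

theorem eq_a_zpow_ht (g : BS 0) : g = a 0 ^ ht g := by
  obtain ⟨n, m, k, rfl⟩ := exists_normal_form 0 g
  rw [ht_normal_form, b_zero_eq_one, one_zpow, mul_one, sub_eq_neg_add, zpow_add, zpow_neg,
    zpow_natCast]

theorem isLeftOrder_ht_zero :
    IsLeftOrder (fun g h : BS 0 => g⁻¹ * h ∈ {g : BS 0 | 0 < ht g}) := by
  refine isLeftOrder_of_posCone _ ?_ (by simp) fun g hg => ?_
  · intro g hg h hh
    simp only [Set.mem_ofPred_eq, ht_mul] at *
    omega
  · have : ht g ≠ 0 := fun h => hg (by rw [eq_a_zpow_ht g, h, zpow_zero])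
    simp only [Set.mem_ofPred_eq, ht_inv]
    omega

theorem setOf_ht_pos_eq : {g : BS 0 | 0 < ht g} =
    {a 0} * (Submonoid.closure {a 0} : Set (BS 0)) := by
  ext g
  constructor
  · intro h
    simp only [Set.mem_ofPred_eq] at h
    refine ⟨a _, rfl, a _ ^ (ht g - 1).toNat, pow_mem_closure_self _ _, ?_⟩
    have h2 : a 0 * a 0 ^ (ht g - 1).toNat = a 0 ^ ht g := by
      rw [← zpow_natCast, ← zpow_one_add]
      congr 1
      omega
    exact h2.trans (eq_a_zpow_ht g).symm
  · rintro ⟨_, rfl, y, hy, rfl⟩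
    obtain ⟨n, rfl⟩ := Submonoid.mem_closure_singleton.mp hy
    simp
    omega

theorem exists_isRegularLeftOrder {X : Type*} (π : FreeMonoid X →* BS q)
    (hπ : Function.Surjective π) (hq : -1 ≤ q) :
    ∃ lt : BS q → BS q → Prop, IsRegularLeftOrder π lt := by
  have sing := isRepresentedBy_regular_singleton hπ
  have hsplit : 0 < q ∨ q = 0 ∨ q = -1 := by omega
  rcases hsplit with hq | rfl | rfl
  · have : NeZero q := ⟨hq.ne'⟩
    refine ⟨_, isLeftOrder_transCone hq, ?_⟩
    rw [posCone_inv_mul_mem, transCone_eq hq]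
    exact (((sing _).closure_regular.mul_regular (sing _)).mul_regular
      (((sing _).union_regular (sing _)).union_regular (sing _)).closure_regular).union_regular
      ((sing _).mul_regular (sing _).closure_regular)
  · refine ⟨_, isLeftOrder_ht_zero, ?_⟩
    rw [posCone_inv_mul_mem, setOf_ht_pos_eq]
    exact (sing _).mul_regular (sing _).closure_regular
  · refine ⟨_, isLeftOrder_heightCone, ?_⟩
    rw [posCone_inv_mul_mem, heightCone_neg_one_eq]
    exact ((sing _).mul_regular (sing _).closure_regular).union_regular
      (((sing _).union_regular (sing _)).closure_regular.mul_regular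
        ((sing _).mul_regular (sing _).closure_regular))

end BS

/-! ### Non-regularity of the left-orders with convex kernel of the height -/

namespace BS

variable {q : ℤ}

/-- For `ε = 1`, replace the suffix by one from a finite set: the total height stays nonnegative,
which bounds the height of `u`. For `ε = -1`, replace the prefix instead; `v` has height opposite to
that of `u`, which gives the same bound. -/
theorem exists_neg_le_ht_of_append_mem {X : Type*} {π : FreeMonoid X →* BS q} {L : Language X}
    (hL : L.IsRegular) {ε : ℤ} (hε : ε = 1 ∨ ε = -1)
    (hpos : ∀ w ∈ L, 0 ≤ ε * ht (π (FreeMonoid.ofList w))) :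
    ∃ C : ℕ, ∀ u v, u ++ v ∈ L → ht (π (FreeMonoid.ofList (u ++ v))) = 0 →
      -(C : ℤ) ≤ ht (π (FreeMonoid.ofList u)) := by
  have bound : ∀ V : Set (List X), V.Finite →
      ∃ C : ℕ, ∀ v ∈ V, |ht (π (FreeMonoid.ofList v))| ≤ C := by
    intro V hV
    obtain ⟨C, hC⟩ := (hV.image fun v => (ht (π (FreeMonoid.ofList v))).natAbs).bddAbove
    refine ⟨C, fun v hv => ?_⟩
    have := hC ⟨v, hv, rfl⟩
    rw [Int.abs_eq_natAbs]
    exact_mod_cast this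
  simp only [FreeMonoid.ofList_append, map_mul, ht_mul]
  rcases hε with rfl | rfl
  · obtain ⟨V, hV, h⟩ := hL.exists_finite_suffixes
    obtain ⟨C, hC⟩ := bound V hV
    refine ⟨C, fun u v huv _ => ?_⟩
    obtain ⟨v', hv', huv'⟩ := h u v huv
    have h1 := hpos _ huv'
    have h2 := abs_le.mp (hC v' hv')
    rw [FreeMonoid.ofList_append, map_mul, ht_mul] at h1
    omega
  · obtain ⟨U, hU, h⟩ := hL.exists_finite_prefixes
    obtain ⟨C, hC⟩ := bound U hU
    refine ⟨C, fun u v huv h0 => ?_⟩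
    obtain ⟨u', hu', huv'⟩ := h u v huv
    have h1 := hpos _ huv'
    have h2 := abs_le.mp (hC u' hu')
    rw [FreeMonoid.ofList_append, map_mul, ht_mul] at h1
    omega

section NeZero

variable [NeZero q]

theorem exists_trans_eq_of_le {x : ℝ} {n : ℕ} {m : ℤ} (hx : x = (q : ℝ) ^ (-(n : ℤ)) * m)
    {N : ℤ} (hN : (n : ℤ) ≤ N) : ∃ m' : ℤ, x = (q : ℝ) ^ (-N) * m' := by
  obtain ⟨k, rfl⟩ := Int.le.dest hN
  refine ⟨q ^ k * m, ?_⟩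
  rw [hx, neg_add, zpow_add₀ cast_ne_zero, Int.cast_mul, Int.cast_pow, zpow_neg (q : ℝ) (k : ℤ),
    zpow_natCast (q : ℝ) k]
  have := cast_ne_zero (q := q)
  field_simp

theorem exists_trans_eq_uniform {X : Type*} [Finite X] (f : X → BS q) :
    ∃ D : ℕ, ∀ x, ∃ m : ℤ, trans (f x) = (q : ℝ) ^ (-(D : ℤ)) * m := by
  choose n m h using fun x => exists_trans_eq (f x)
  obtain ⟨D, hD⟩ := Finite.exists_le n
  exact ⟨D, fun x => exists_trans_eq_of_le (h x) (by exact_mod_cast hD x)⟩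

/-- A letter read at height h contributes qʰ times its own translation part, so prefixes of height
at least `-C` give denominators dividing a fixed power of q. -/
theorem trans_eq_of_forall_neg_le_ht {X : Type*} {π : FreeMonoid X →* BS q} {C D : ℕ}
    (hD : ∀ x, ∃ m : ℤ, trans (π (FreeMonoid.of x)) = (q : ℝ) ^ (-(D : ℤ)) * m) (w : List X)
    (hw : ∀ u v, u ++ v = w → -(C : ℤ) ≤ ht (π (FreeMonoid.ofList u))) :
    ∃ m : ℤ, trans (π (FreeMonoid.ofList w)) = (q : ℝ) ^ (-((C + D : ℕ) : ℤ)) * m := by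
  induction w using List.reverseRecOn with
  | nil => exact ⟨0, by simp⟩
  | append_singleton w x ih =>
    obtain ⟨m, hm⟩ := ih fun u v huv => hw u (v ++ [x]) (by rw [← List.append_assoc, huv])
    obtain ⟨m', hm'⟩ := hD x
    obtain ⟨k, hk⟩ := Int.le.dest (hw w [x] rfl)
    refine ⟨m + q ^ k * m', ?_⟩
    rw [FreeMonoid.ofList_append, map_mul, trans_mul, hm, FreeMonoid.ofList_singleton, hm', ← hk,
      zpow_add₀ cast_ne_zero]
    push_cast
    rw [neg_add, zpow_add₀ cast_ne_zero, zpow_natCast _ k]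
    ring

theorem not_isRegularLeftOrder_of_sign {X : Type*} [Finite X] {π : FreeMonoid X →* BS q}
    (hq : 2 ≤ |q|) {lt : BS q → BS q → Prop} {ε : ℤ} (hε : ε = 1 ∨ ε = -1)
    (hlt : ∀ g, 0 < ε * ht g → lt 1 g) : ¬ IsRegularLeftOrder π lt := by
  rintro ⟨H, L, hL, hP⟩
  have hmem : ∀ w ∈ L, lt 1 (π (FreeMonoid.ofList w)) := fun w hw => hP.subset ⟨w, hw, rfl⟩
  have hpos : ∀ w ∈ L, 0 ≤ ε * ht (π (FreeMonoid.ofList w)) := by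
    intro w hw
    by_contra! hneg
    have h1 := hlt (π (FreeMonoid.ofList w))⁻¹ (by rw [ht_inv]; linarith)
    rw [← H.lt_one_iff] at h1
    exact H.asymm h1 (hmem w hw)
  obtain ⟨C, hC⟩ := exists_neg_le_ht_of_append_mem hL hε hpos
  obtain ⟨D, hD⟩ := exists_trans_eq_uniform fun x => π (FreeMonoid.of x)
  have key : ∀ g, lt 1 g → ht g = 0 →
      ∃ m : ℤ, trans g = (q : ℝ) ^ (-((C + D : ℕ) : ℤ)) * m := by
    intro g hg h0
    obtain ⟨w, hw, rfl⟩ := hP.superset hg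
    exact trans_eq_of_forall_neg_le_ht hD w fun u v huv =>
      hC u v (by rwa [huv]) (by rwa [huv])
  have key' : ∀ g : BS q, ht g = 0 →
      ∃ m : ℤ, trans g = (q : ℝ) ^ (-((C + D : ℕ) : ℤ)) * m := by
    intro g h0
    rcases H.eq_or_lt_or_gt 1 g with rfl | h | h
    · exact ⟨0, by simp⟩
    · exact key g h h0
    · obtain ⟨m, hm⟩ := key g⁻¹ ((H.lt_one_iff g).mp h) (by simp [h0])
      refine ⟨-m, ?_⟩
      rw [trans_inv, h0, neg_zero, zpow_zero, one_mul] at hm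
      rw [Int.cast_neg, mul_neg, ← hm, neg_neg]
  -- One denominator more than allowed: translation part q^{-(C+D+1)} would make q a unit of ℤ.
  obtain ⟨m, hm⟩ := key' ((a q ^ (C + D + 1))⁻¹ * b q ^ (1 : ℤ) * a q ^ ((C + D + 1 : ℕ) : ℤ))
    (by rw [ht_normal_form, sub_self])
  rw [trans_normal_form, Nat.cast_succ, neg_add, zpow_add₀ cast_ne_zero, mul_assoc,
    mul_right_inj' (zpow_ne_zero _ cast_ne_zero), zpow_neg_one, Int.cast_one, mul_one] at hm
  have h1 : q * m = 1 := by
    have := mul_inv_cancel₀ (cast_ne_zero (q := q))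
    rw [hm] at this
    exact_mod_cast this
  have h2 := Int.isUnit_iff_abs_eq.mp (IsUnit.of_mul_eq_one m h1)
  omega

end NeZero

end BS

/-! ### Left-orders in which the kernel of the height is cofinal -/

namespace BS

variable {q : ℤ} [NeZero q] {lt : BS q → BS q → Prop}

/-- Clearing the denominator makes a power of `s` equal to a positive power of b; `q.natAbs` keeps
the exponent natural when q is negative. -/
theorem one_lt_of_trans_pos (H : IsLeftOrder lt) (hb : lt 1 (b q)) {s : BS q} (hs : ht s = 0)
    (hpos : 0 < trans s) : lt 1 s := by
  obtain ⟨n, m, h⟩ := exists_trans_eq s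
  have hq : (q : ℝ) ≠ 0 := cast_ne_zero
  have hint : ∃ k : ℕ, s ^ (q.natAbs ^ n) = b q ^ k := by
    obtain ⟨k, hk⟩ : ∃ k : ℤ, ((q.natAbs ^ n : ℕ) : ℝ) * trans s = k := by
      rw [h, Nat.cast_pow, Nat.cast_natAbs, Int.cast_abs, ← abs_pow]
      rcases abs_choice ((q : ℝ) ^ n) with h | h
      · exact ⟨m, by rw [h, zpow_neg, zpow_natCast, mul_inv_cancel_left₀ (pow_ne_zero _ hq)]⟩
      · exact ⟨-m, by
          rw [h, zpow_neg, zpow_natCast, neg_mul, mul_inv_cancel_left₀ (pow_ne_zero _ hq),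
            Int.cast_neg]⟩
    have hk0 : 0 ≤ k := by
      have : (0 : ℝ) ≤ k := hk ▸ by positivity
      exact_mod_cast this
    lift k to ℕ using hk0
    refine ⟨k, ext_ht_trans (by simp [hs]) ?_⟩
    rw [trans_pow_of_ht_eq_zero hs, hk, trans_pow_of_ht_eq_zero ht_b]
    simp
  obtain ⟨k, hk⟩ := hint
  have hN : q.natAbs ^ n ≠ 0 := pow_ne_zero _ (by simpa using NeZero.ne q)
  have hk0 : k ≠ 0 := by
    rintro rfl
    have h2 := trans_pow_of_ht_eq_zero hs (q.natAbs ^ n)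
    rw [hk, pow_zero, trans_one, eq_comm, mul_eq_zero] at h2
    exact h2.elim (Nat.cast_ne_zero.mpr hN) hpos.ne'
  exact H.one_lt_of_one_lt_pow (hk ▸ H.one_lt_pow hb hk0)

theorem lt_iff_trans_lt (H : IsLeftOrder lt) (hb : lt 1 (b q)) {s t : BS q} (hs : ht s = 0)
    (ht' : ht t = 0) : lt s t ↔ trans s < trans t := by
  have key : ∀ {s t : BS q}, ht s = 0 → ht t = 0 → trans s < trans t → lt s t := by
    intro s t hs ht' h
    rw [H.lt_iff_one_lt]
    refine one_lt_of_trans_pos H hb (by simp [hs, ht']) ?_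
    rw [trans_mul, trans_inv, ht_inv, hs]
    simpa using h
  refine ⟨fun h => ?_, key hs ht'⟩
  by_contra! hle
  rcases hle.lt_or_eq with h1 | h1
  · exact H.asymm h (key ht' hs h1)
  · rw [ext_ht_trans (hs.trans ht'.symm) h1.symm] at h
    exact H.irrefl _ h

omit [NeZero q] in
-- Left-invariance alone suffices: with s' = aⁿsa⁻ⁿ one has s't < s'aⁿ = aⁿs < aⁿ⁺ᵐ, and s' commutes
-- with t.
theorem conj_mul_lt (H : IsLeftOrder lt) {n m : ℤ} {s t : BS q} (ht1 : lt t (a q ^ n))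
    (hs : lt s (a q ^ m)) (hcomm : Commute t (a q ^ n * s * (a q ^ n)⁻¹)) :
    lt (t * (a q ^ n * s * (a q ^ n)⁻¹)) (a q ^ (n + m)) := by
  rw [hcomm.eq, zpow_add]
  refine H.trans (g := a q ^ n * s) ?_ ((H.mul_left_iff _ _ _).mpr hs)
  conv_rhs => rw [← inv_mul_cancel_right (a q ^ n * s) (a q ^ n)]
  exact (H.mul_left_iff _ _ _).mpr ht1

theorem commute_of_ht_eq_zero {s t : BS q} (hs : ht s = 0) (ht' : ht t = 0) : Commute s t :=
  ext_ht_trans (by simp [hs, ht']) (by rw [trans_mul, trans_mul, hs, ht']; simp [add_comm])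

theorem trans_conj_a (s : BS q) (n : ℤ) :
    trans (a q ^ n * s * (a q ^ n)⁻¹) = (q : ℝ) ^ n * trans s := by
  rw [trans_mul, trans_mul, trans_inv, trans_a_zpow]
  simp

/-- The lower bounds of `a ^ n` and `a ^ m` in the kernel of the height combine to a lower bound of
`a ^ (n + m)`. -/
theorem exists_mul_lt (H : IsLeftOrder lt) {n m : ℤ} {s t : BS q} (hs0 : ht s = 0) (ht0 : ht t = 0)
    (ht1 : lt t (a q ^ n)) (hs : lt s (a q ^ m)) :
    ∃ r, ht r = 0 ∧ trans r = trans t + (q : ℝ) ^ n * trans s ∧ lt r (a q ^ (n + m)) :=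
  ⟨_, by simp [hs0, ht0], by rw [trans_mul, trans_conj_a, ht0]; simp,
    conj_mul_lt H ht1 hs (commute_of_ht_eq_zero ht0 (by simp [hs0]))⟩

/-- Lowering a lower bound of a by bʲ leaves it a lower bound, but for negative q conjugation by a
turns it into a large upward shift. The lower bounds of a² so obtained would then exceed any upper
bound `u`. -/
theorem pos_of_cofinal (H : IsLeftOrder lt) (hb : lt 1 (b q))
    (hcof : ∀ g, (∃ s : BS q, ht s = 0 ∧ lt s g) ∧ ∃ s, ht s = 0 ∧ lt g s) : 0 < q := by
  by_contra! hq
  have hq1 : (q : ℝ) ≤ -1 := by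
    have h0 := NeZero.ne q
    have : q ≤ -1 := by omega
    exact_mod_cast this
  obtain ⟨⟨s, hs0, hs⟩, -⟩ := hcof (a q ^ (1 : ℤ))
  obtain ⟨-, ⟨u, hu0, hu⟩⟩ := hcof (a q ^ (1 + 1 : ℤ))
  obtain ⟨j, hj⟩ := exists_nat_gt (trans u - trans s - q * trans s)
  have hs' : ht ((b q ^ j)⁻¹ * s) = 0 := by simp [hs0]
  have htr : trans ((b q ^ j)⁻¹ * s) = trans s - j := by
    rw [trans_mul, trans_inv, trans_pow_of_ht_eq_zero ht_b]
    simp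
    ring
  have hlt : lt ((b q ^ j)⁻¹ * s) (a q ^ (1 : ℤ)) := by
    rcases j.eq_zero_or_pos with rfl | hj0
    · simpa using hs
    · refine H.trans ((lt_iff_trans_lt H hb hs' hs0).mpr ?_) hs
      rw [htr]
      have : (0 : ℝ) < j := by exact_mod_cast hj0
      linarith
  obtain ⟨r, hr0, hr, hra⟩ := exists_mul_lt H hs' hs0 hs hlt
  have h1 := (lt_iff_trans_lt H hb hr0 hu0).mp (H.trans hra hu)
  rw [hr, htr, zpow_one] at h1
  have : (0 : ℝ) ≤ j := by positivity
  nlinarith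

theorem exists_trans_between (hq : 1 < q) {x y : ℝ} (hxy : x < y) :
    ∃ s : BS q, ht s = 0 ∧ x < trans s ∧ trans s < y := by
  have hq1 : (1 : ℝ) < q := by exact_mod_cast hq
  obtain ⟨n, hn⟩ := pow_unbounded_of_one_lt (1 / (y - x)) hq1
  have hpos : (0 : ℝ) < (q : ℝ) ^ n := by positivity
  rw [div_lt_iff₀ (sub_pos.mpr hxy)] at hn
  refine ⟨(a q ^ n)⁻¹ * b q ^ (⌊(q : ℝ) ^ n * x⌋ + 1) * a q ^ (n : ℤ), by simp, ?_⟩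
  rw [trans_normal_form, zpow_neg, zpow_natCast, Int.cast_add, Int.cast_one, lt_inv_mul_iff₀ hpos,
    inv_mul_lt_iff₀ hpos]
  have h1 := Int.floor_le ((q : ℝ) ^ n * x)
  have h2 := Int.lt_floor_add_one ((q : ℝ) ^ n * x)
  exact ⟨h2, by nlinarith⟩

variable (lt) in
/-- The position of `a ^ n` with respect to the kernel of the height. -/
noncomputable def cut (n : ℤ) : ℝ := sSup (trans '' {s | ht s = 0 ∧ lt s (a q ^ n)})

/-! ### The cuts made in ℤ[1/q] by the powers of a -/

section Cut

variable (H : IsLeftOrder lt) (hb : lt 1 (b q))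
  (hcof : ∀ g, (∃ s : BS q, ht s = 0 ∧ lt s g) ∧ ∃ s, ht s = 0 ∧ lt g s)

include H hb hcof

theorem trans_le_cut {n : ℤ} {s : BS q} (hs0 : ht s = 0) (hs : lt s (a q ^ n)) :
    trans s ≤ cut lt n := by
  refine le_csSup ?_ ⟨s, ⟨hs0, hs⟩, rfl⟩
  obtain ⟨-, u, hu0, hu⟩ := hcof (a q ^ n)
  refine ⟨trans u, ?_⟩
  rintro _ ⟨r, ⟨hr0, hr⟩, rfl⟩
  exact ((lt_iff_trans_lt H hb hr0 hu0).mp (H.trans hr hu)).le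

theorem lt_of_trans_lt_cut {n : ℤ} {s : BS q} (hs0 : ht s = 0) (hs : trans s < cut lt n) :
    lt s (a q ^ n) := by
  obtain ⟨⟨u, hu0, hu⟩, -⟩ := hcof (a q ^ n)
  obtain ⟨_, ⟨r, ⟨hr0, hr⟩, rfl⟩, hsr⟩ := exists_lt_of_lt_csSup
    (Set.Nonempty.image trans (s := {s | ht s = 0 ∧ lt s (a q ^ n)}) ⟨u, hu0, hu⟩) hs
  exact H.trans ((lt_iff_trans_lt H hb hs0 hr0).mpr hsr) hr

theorem cut_le_of_lt {n : ℤ} {s : BS q} (hs0 : ht s = 0) (hs : lt (a q ^ n) s) :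
    cut lt n ≤ trans s := by
  by_contra! h
  exact H.asymm hs (lt_of_trans_lt_cut H hb hcof hs0 h)

theorem lt_of_cut_lt_trans (hq : 1 < q) {n : ℤ} {s : BS q} (hs0 : ht s = 0)
    (hs : cut lt n < trans s) : lt (a q ^ n) s := by
  obtain ⟨r, hr0, h1, h2⟩ := exists_trans_between hq hs
  have hrs := (lt_iff_trans_lt H hb hr0 hs0).mpr h2
  rcases H.eq_or_lt_or_gt (a q ^ n) r with h | h | h
  · rwa [h]
  · exact H.trans h hrs
  · exact absurd (trans_le_cut H hb hcof hr0 h) (not_le.mpr h1)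

/-- Kernel elements close to the two cuts, which exist by density of ℤ[1/q], combine through
`exists_mul_lt`; the reversed order gives the other inequality. -/
theorem cut_add (hq : 1 < q) (n m : ℤ) : cut lt (n + m) = cut lt n + (q : ℝ) ^ n * cut lt m := by
  have hqn : (0 : ℝ) < (q : ℝ) ^ n := zpow_pos (by exact_mod_cast (by omega : 0 < q)) n
  apply le_antisymm
  · by_contra! h
    -- Half the gap goes to each summand; the second share is divided by qⁿ because the cocycle
    -- rescales it.
    obtain ⟨δ, hδ, he⟩ : ∃ δ, 0 < δ ∧ cut lt n + δ + (q : ℝ) ^ n * (cut lt m + δ / (q : ℝ) ^ n) =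
        cut lt (n + m) := ⟨(cut lt (n + m) - (cut lt n + (q : ℝ) ^ n * cut lt m)) / 2,
          by linarith, by field_simp; ring⟩
    obtain ⟨t, ht0, h1, h2⟩ := exists_trans_between hq (lt_add_of_pos_right (cut lt n) hδ)
    obtain ⟨s, hs0, h3, h4⟩ :=
      exists_trans_between hq (lt_add_of_pos_right (cut lt m) (div_pos hδ hqn))
    obtain ⟨r, hr0, hr, hra⟩ := exists_mul_lt H.swap (lt := fun g h => lt h g) hs0 ht0
      (lt_of_cut_lt_trans H hb hcof hq ht0 h1) (lt_of_cut_lt_trans H hb hcof hq hs0 h3)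
    have h5 := cut_le_of_lt H hb hcof hr0 hra
    have h6 := mul_lt_mul_of_pos_left h4 hqn
    linarith
  · by_contra! h
    obtain ⟨δ, hδ, he⟩ : ∃ δ, 0 < δ ∧ cut lt n - δ + (q : ℝ) ^ n * (cut lt m - δ / (q : ℝ) ^ n) =
        cut lt (n + m) := ⟨(cut lt n + (q : ℝ) ^ n * cut lt m - cut lt (n + m)) / 2,
          by linarith, by field_simp; ring⟩
    obtain ⟨t, ht0, h1, h2⟩ := exists_trans_between hq (sub_lt_self (cut lt n) hδ)
    obtain ⟨s, hs0, h3, h4⟩ :=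
      exists_trans_between hq (sub_lt_self (cut lt m) (div_pos hδ hqn))
    obtain ⟨r, hr0, hr, hra⟩ := exists_mul_lt H hs0 ht0
      (lt_of_trans_lt_cut H hb hcof ht0 h2) (lt_of_trans_lt_cut H hb hcof hs0 h4)
    have h5 := trans_le_cut H hb hcof hr0 hra
    have h6 := mul_lt_mul_of_pos_left h3 hqn
    linarith

theorem exists_one_lt_of_lt_affine (hq : 1 < q) :
    ∃ x : ℝ, ∀ g : BS q, x < (q : ℝ) ^ ht g * x + trans g → lt 1 g := by
  have hq1 : (1 : ℝ) < q := by exact_mod_cast hq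
  refine ⟨cut lt 1 / (q - 1), fun g hg => ?_⟩
  -- Expanding the cut of n + 1 in both orders shows that it equals (qⁿ - 1)x at n, with x as
  -- chosen.
  have h1 := cut_add H hb hcof hq (ht g) 1
  rw [add_comm, cut_add H hb hcof hq 1 (ht g), zpow_one] at h1
  have h2 : cut lt (ht g) = ((q : ℝ) ^ ht g - 1) * (cut lt 1 / (q - 1)) := by
    have : (q : ℝ) - 1 ≠ 0 := by linarith
    field_simp
    linarith
  obtain ⟨s, hs⟩ : ∃ s, s = g * (a q ^ ht g)⁻¹ := ⟨_, rfl⟩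
  have hs0 : ht s = 0 := by simp [hs]
  have hst : trans s = trans g := by
    rw [hs, trans_mul, trans_inv, trans_a_zpow]
    simp
  have hlt : lt s⁻¹ (a q ^ ht g) := by
    refine lt_of_trans_lt_cut H hb hcof (by simp [hs0]) ?_
    rw [trans_inv, hs0, h2, hst]
    simp only [neg_zero, zpow_zero, one_mul]
    linarith
  rw [H.lt_iff_one_lt] at hlt
  simpa [hs] using hlt

end Cut

end BS

/-! ### Left-orders induced by the affine action -/

theorem IsInducedBy.swap {G Ω : Type*} [Group G] [LinearOrder Ω] {ρ : G →* (Ω ≃o Ω)}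
    {lt : G → G → Prop} (h : IsInducedBy ρ fun g h => lt h g) : IsInducedBy ρ lt := by
  obtain ⟨x, lt', H, h⟩ := h
  have hinv : ∀ g h : G, (∃ s : stabAt ρ x, g = h * s ∧ lt' 1 s) ↔
      ∃ s : stabAt ρ x, h = g * s ∧ lt' s 1 := by
    intro g h
    constructor
    · rintro ⟨s, rfl, hs⟩
      exact ⟨s⁻¹, by simp, by rwa [H.lt_one_iff, inv_inv]⟩
    · rintro ⟨s, rfl, hs⟩
      exact ⟨s⁻¹, by simp, by rwa [← H.lt_one_iff]⟩
  -- Reversal exchanges the two orientations and must also reverse the order on the stabilizer.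
  refine ⟨x, fun s t => lt' t s, H.swap, h.symm.imp (fun h g k => ?_) fun h g k => ?_⟩
  · exact (h k g).trans (or_congr_right (hinv g k))
  · exact (h k g).trans (or_congr_right (hinv g k))

theorem IsLeftOrder.isInducedBy {G Ω : Type*} [Group G] [LinearOrder Ω] {ρ : G →* (Ω ≃o Ω)}
    {lt : G → G → Prop} (H : IsLeftOrder lt) {x : Ω} (hx : ∀ g, x < ρ g x → lt 1 g) :
    IsInducedBy ρ lt := by
  have hlt : ∀ g h, ρ g x < ρ h x → lt g h := by
    intro g h hgh
    rw [H.lt_iff_one_lt]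
    refine hx _ ((ρ g).lt_iff_lt.mp ?_)
    rwa [← RelIso.mul_apply, ← map_mul, mul_inv_cancel_left]
  refine ⟨x, fun s t => lt s t, H.restrict _, Or.inl fun g h => ⟨fun hgh => ?_, ?_⟩⟩
  · rcases lt_trichotomy (ρ g x) (ρ h x) with h1 | h1 | h1
    · exact Or.inl h1
    · refine Or.inr ⟨⟨g⁻¹ * h, ?_⟩, by simp, (H.lt_iff_one_lt g h).mp hgh⟩
      change ρ (g⁻¹ * h) x = x
      rw [map_mul, RelIso.mul_apply, ← h1, ← RelIso.mul_apply, ← map_mul]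
      simp
    · exact absurd hgh (H.asymm (hlt h g h1))
  · rintro (h1 | ⟨s, rfl, hs⟩)
    · exact hlt g h h1
    · rw [H.lt_iff_one_lt, inv_mul_cancel_left]
      exact hs

namespace BS

variable {q : ℤ}

theorem exists_sign_or_induced [NeZero q] (hq : 2 ≤ |q|) {lt : BS q → BS q → Prop}
    (H : IsLeftOrder lt) :
    (∃ ε : ℤ, (ε = 1 ∨ ε = -1) ∧ ∀ g, 0 < ε * ht g → lt 1 g) ∨
      ∃ h : 0 < q, IsInducedBy (bsAffine q h) lt := by
  have main : ∀ {lt : BS q → BS q → Prop}, IsLeftOrder lt → lt 1 (b q) →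
      (∃ ε : ℤ, (ε = 1 ∨ ε = -1) ∧ ∀ g, 0 < ε * ht g → lt 1 g) ∨
        ∃ h : 0 < q, IsInducedBy (bsAffine q h) lt := by
    intro lt H hb
    refine (H.sign_or_cofinal_ker (height q) ((height_eq_one_iff _).mpr ht_b) hb).imp id
      fun hcof => ?_
    simp only [height_eq_one_iff] at hcof
    have hpos := pos_of_cofinal H hb hcof
    rw [abs_of_pos hpos] at hq
    obtain ⟨x, hx⟩ := exists_one_lt_of_lt_affine H hb hcof (by omega)
    exact ⟨hpos, H.isInducedBy fun g hg => hx g (by rwa [← bsAffine_apply hpos])⟩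
  rcases H.eq_or_lt_or_gt 1 (b q) with h | h | h
  · have := congrArg trans h
    simp at this
  · exact main H h
  · rcases main H.swap h with ⟨ε, hε, hlt⟩ | ⟨hpos, hind⟩
    · refine Or.inl ⟨-ε, by omega, fun g hg => ?_⟩
      have := hlt g⁻¹ (by rw [ht_inv]; linarith)
      rwa [H.lt_one_iff, inv_inv] at this
    · exact Or.inr ⟨hpos, hind.swap⟩

end BS

/-! ### One-counter languages -/

namespace PDA

variable {X A S B Γ : Type*}

theorem Run.trans {M : PDA X S Γ} {c c' c'' : S × List Γ} {v w : List X} (h : M.Run c v c')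
    (h' : M.Run c' w c'') : M.Run c (v ++ w) c'' := by
  induction h with
  | nil => exact h'
  | cons hs _ ih =>
    rw [List.append_assoc]
    exact .cons hs (ih h')

theorem Run.of_mem_δ {M : PDA X S Γ} {s s' : S} {o : Option X} {u v u' : List Γ}
    (h : (s', v) ∈ M.δ s o u.getLast?) (hu : u' = u.dropLast ++ v) :
    M.Run (s, u) o.toList (s', u') := by
  simpa using Run.cons (M := M) (c := (s, u)) ⟨v, h, hu⟩ (.nil (s', u'))

theorem dropLast_append_getLast?_toList (u : List Γ) : u.dropLast ++ u.getLast?.toList = u := by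
  induction u using List.reverseRecOn <;> simp

theorem Run.cons_of_keep {M : PDA X S Γ} {s s' : S} {x : X} {w : List X} {u : List Γ}
    {c : S × List Γ} (h : (s', u.getLast?.toList) ∈ M.δ s (some x) u.getLast?)
    (h' : M.Run (s', u) w c) : M.Run (s, u) (x :: w) c :=
  .cons (o := some x) ⟨_, h, (dropLast_append_getLast?_toList u).symm⟩ h'

/-- The automaton that reads the word `f x` instead of the letter `x`. A state of `M` is stored
together with the part of the current word that remains to be read; these parts are encoded by
`B`. -/
def substitute [Finite A] [Finite B] (M : PDA A S Γ) (f : A → List X) (rem : B → List X) (k₀ : B) :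
    PDA X (S × B) Γ where
  δ c o t := match o with
    | some x => {p | ∃ k, rem c.2 = x :: rem k ∧ p = ((c.1, k), t.toList)}
    | none => {p | rem c.2 = [] ∧ ∃ o, (p.1.1, p.2) ∈ M.δ c.1 o t ∧ rem p.1.2 = o.elim [] f}
  finite_δ c o t := by
    cases o with
    | some x =>
      refine (Set.finite_range fun k => ((c.1, k), t.toList)).subset ?_
      rintro _ ⟨k, -, rfl⟩
      exact ⟨k, rfl⟩
    | none =>
      refine ((((Set.finite_iUnion fun o => M.finite_δ c.1 o t).prod
        (Set.toFinite (Set.univ : Set B)))).image fun p => ((p.1.1, p.2), p.1.2)).subset ?_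
      rintro ⟨⟨s, k⟩, v⟩ ⟨-, o, h, -⟩
      exact ⟨((s, v), k), ⟨Set.mem_iUnion.mpr ⟨o, h⟩, trivial⟩, rfl⟩
  start := (M.start, k₀)
  stack₀ := M.stack₀
  accept := {c | c.1 ∈ M.accept ∧ rem c.2 = []}

/-! ### Correctness of the substitution automaton -/

section substitute

variable [Finite A] [Finite B] {M : PDA A S Γ} {f : A → List X} {rem : B → List X} {k₀ : B}

theorem Run.of_substitute {c c' : (S × B) × List Γ} {w : List X}
    (h : (M.substitute f rem k₀).Run c w c') (hc' : rem c'.1.2 = []) :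
    ∃ v : List A, w = rem c.1.2 ++ v.flatMap f ∧ M.Run (c.1.1, c.2) v (c'.1.1, c'.2) := by
  induction h with
  | nil c => exact ⟨[], by simp [hc'], .nil _⟩
  | @cons c d c'' o w hs _ ih =>
    obtain ⟨v, rfl, hv⟩ := ih hc'
    obtain ⟨u, hu, hd⟩ := hs
    cases o with
    | some x =>
      obtain ⟨k, hk, he⟩ := hu
      obtain ⟨h1, h2⟩ := Prod.ext_iff.mp he
      simp only at h1 h2
      rw [h2, dropLast_append_getLast?_toList] at hd
      rw [h1, hd] at hv
      exact ⟨v, by rw [h1, hk]; simp, hv⟩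
    | none =>
      obtain ⟨hnil, o, ho, hk⟩ := hu
      refine ⟨o.toList ++ v, ?_, .cons ⟨u, ho, hd⟩ hv⟩
      rw [hnil, hk]
      cases o <;> simp

theorem run_substitute_rem (htail : ∀ k x w, rem k = x :: w → ∃ k', rem k' = w) (s : S)
    (u : List Γ) (k : B) : ∃ k', rem k' = [] ∧
      (M.substitute f rem k₀).Run ((s, k), u) (rem k) ((s, k'), u) := by
  obtain ⟨w, hw⟩ : ∃ w, rem k = w := ⟨_, rfl⟩
  rw [hw]
  induction w generalizing k with
  | nil => exact ⟨k, hw, .nil _⟩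
  | cons x w ih =>
    obtain ⟨k', hk'⟩ := htail k x w hw
    obtain ⟨k'', h1, h2⟩ := ih k' hk'
    refine ⟨k'', h1, .cons (o := some x) (c' := ((s, k'), u)) ⟨u.getLast?.toList, ?_, ?_⟩ h2⟩
    · exact ⟨k', by rw [hk', hw], rfl⟩
    · exact (dropLast_append_getLast?_toList u).symm

theorem Run.substitute (hnil : ∃ k, rem k = []) (hf : ∀ x, ∃ k, rem k = f x)
    (htail : ∀ k x w, rem k = x :: w → ∃ k', rem k' = w) {c c' : S × List Γ} {v : List A}
    (h : M.Run c v c') {k : B} (hk : rem k = []) : ∃ k', rem k' = [] ∧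
      (M.substitute f rem k₀).Run ((c.1, k), c.2) (v.flatMap f) ((c'.1, k'), c'.2) := by
  induction h generalizing k with
  | nil c => exact ⟨k, hk, .nil _⟩
  | @cons c d c'' o v hs _ ih =>
    obtain ⟨k₁, hk₁⟩ : ∃ k, rem k = o.elim [] f := by
      cases o with
      | none => exact hnil
      | some x => exact hf x
    obtain ⟨k₂, hk₂, h2⟩ := run_substitute_rem (M := M) (f := f) (k₀ := k₀) htail d.1 d.2 k₁
    obtain ⟨k₃, hk₃, h3⟩ := ih hk₂
    obtain ⟨u, hu, hd⟩ := hs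
    refine ⟨k₃, hk₃, ?_⟩
    have h1 : (M.substitute f rem k₀).Run ((c.1, k), c.2) [] ((d.1, k₁), d.2) :=
      .of_mem_δ (o := none) (v := u) ⟨hk, o, hu, hk₁⟩ hd
    have he : (o.toList ++ v).flatMap f = [] ++ (rem k₁ ++ v.flatMap f) := by
      rw [hk₁]
      cases o <;> simp
    rw [he]
    exact h1.trans (h2.trans h3)

theorem accepts_substitute (hk₀ : rem k₀ = []) (hf : ∀ x, ∃ k, rem k = f x)
    (htail : ∀ k x w, rem k = x :: w → ∃ k', rem k' = w) :
    (M.substitute f rem k₀).accepts = {w | ∃ v ∈ M.accepts, v.flatMap f = w} := by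
  ext w
  constructor
  · rintro ⟨c, hc, hacc, hrem⟩
    obtain ⟨v, hv, hrun⟩ := hc.of_substitute hrem
    refine ⟨v, ⟨_, hrun, hacc⟩, ?_⟩
    change w = rem k₀ ++ _ at hv
    rw [hv, hk₀, List.nil_append]
  · rintro ⟨v, ⟨c, hc, hacc⟩, rfl⟩
    obtain ⟨k, hk, h⟩ := hc.substitute (k₀ := k₀) ⟨k₀, hk₀⟩ hf htail hk₀
    exact ⟨_, h, hacc, hk⟩

end substitute

end PDA

/-- This transfers the automaton to an arbitrary generating set. The pending words are suffixes of
the finitely many `f x`; coding them by `Fin n` keeps the states in `Type` whatever the universe of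
`X`. -/
theorem IsOneCounter.substitute {A : Type} {X : Type*} [Finite A] {L : Language A}
    (hL : IsOneCounter L) (f : A → List X) :
    IsOneCounter ({w | ∃ v ∈ L, v.flatMap f = w} : Language X) := by
  obtain ⟨S, Γ, _, M, hΓ, rfl⟩ := hL
  have hfin : (insert [] (⋃ x, {w | w <:+ f x})).Finite :=
    (Set.finite_iUnion fun x => by
      simpa only [← List.mem_tails] using (f x).tails.finite_toSet).insert []
  obtain ⟨n, rem, -, hrem⟩ := hfin.fin_param
  have hnil : [] ∈ Set.range rem := hrem ▸ Set.mem_insert _ _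
  obtain ⟨k₀, hk₀⟩ := hnil
  refine ⟨S × Fin n, Γ, inferInstance, M.substitute f rem k₀, hΓ,
    PDA.accepts_substitute hk₀ (fun x => ?_) fun k x w hk => ?_⟩
  · exact hrem.ge (Or.inr (Set.mem_iUnion.mpr ⟨x, List.suffix_refl _⟩))
  · refine hrem.ge ?_
    rcases hrem.le ⟨k, rfl⟩ with h | h
    · rw [hk] at h
      simp at h
    · obtain ⟨y, hy⟩ := Set.mem_iUnion.mp h
      rw [hk] at hy
      exact Or.inr (Set.mem_iUnion.mpr ⟨y, (List.suffix_cons x w).trans hy⟩)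

theorem Language.IsRegular.isOneCounter {X : Type*} {L : Language X} (hL : L.IsRegular) :
    IsOneCounter L := by
  obtain ⟨σ, _, M, rfl⟩ := hL
  let N : PDA X σ Unit :=
    { δ := fun s o _ => o.elim ∅ fun x => {(M.step s x, [])}
      finite_δ := fun s o t => by cases o <;> simp
      start := M.start
      stack₀ := []
      accept := M.accept }
  have sound : ∀ {c w c'}, N.Run c w c' → c'.1 = M.evalFrom c.1 w := by
    intro c w c' h
    induction h with
    | nil => rfl
    | @cons c d c'' o w hs _ ih =>
      obtain ⟨u, hu, -⟩ := hs
      cases o with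
      | none => exact hu.elim
      | some x =>
        rw [ih]
        exact congrArg (fun s => M.evalFrom s w) (Prod.ext_iff.mp hu).1
  have complete : ∀ (w : List X) (s : σ), N.Run (s, []) w (M.evalFrom s w, []) := by
    intro w
    induction w with
    | nil => exact fun s => .nil _
    | cons x w ih =>
      exact fun s => .cons (o := some x) (c' := (M.step s x, [])) ⟨[], rfl, rfl⟩ (ih _)
  refine ⟨σ, Unit, inferInstance, N, by simp, ?_⟩
  ext w
  constructor
  · rintro ⟨c, hc, hacc⟩
    rw [sound hc] at hacc
    exact hacc
  · exact fun hw => ⟨_, complete w M.start, hw⟩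

/-! ### A one-counter left-order on `BS(1, q)` -/

namespace BS

/-- The letters read by `heightPDA`, standing for `a⁻²`, `a²`, `b`, `b⁻¹` and `a`. -/
inductive Letter
  | down
  | up
  | b
  | bInv
  | a

/-- The states of `heightPDA`. -/
inductive Phase
  | descend
  | ascend
  | bottom
  | positive

instance : Finite Letter :=
  .of_surjective (fun i : Fin 5 => ![Letter.down, .up, .b, .bInv, .a] i) fun x => by
    cases x
    exacts [⟨0, rfl⟩, ⟨1, rfl⟩, ⟨2, rfl⟩, ⟨3, rfl⟩, ⟨4, rfl⟩]

instance : Finite Phase :=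
  .of_surjective (fun i : Fin 4 => ![Phase.descend, .ascend, .bottom, .positive] i) fun x => by
    cases x
    exacts [⟨0, rfl⟩, ⟨1, rfl⟩, ⟨2, rfl⟩, ⟨3, rfl⟩]

/-- The moves of `heightPDA`. -/
def heightPDAδ : Phase → Option Letter → Option Unit → Set (Phase × List Unit)
  | .descend, some .down, t => {(.descend, () :: t.toList)}
  | .descend, some .b, t => {(.ascend, t.toList)}
  | .ascend, some .b, t => {(.ascend, t.toList)}
  | .ascend, some .up, some _ => {(.ascend, [])}
  | .ascend, none, none => {(.bottom, [])}
  | .bottom, some .a, t => {(.positive, t.toList)}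
  | .positive, some .a, t => {(.positive, t.toList)}
  | .positive, some .b, t => {(.positive, t.toList)}
  | .positive, some .bInv, t => {(.positive, t.toList)}
  | _, _, _ => ∅

/-- A one-counter automaton for the positive cone `heightCone`. Before the state `bottom` is
reached, the height is `-2` times the length of the stack word. -/
def heightPDA : PDA Letter Phase Unit where
  δ := heightPDAδ
  finite_δ s o t := by
    rcases s with _ | _ | _ | _ <;> rcases o with _ | (_ | _ | _ | _ | _) <;> rcases t with _ | _ <;>
      simp [heightPDAδ]
  start := .descend
  stack₀ := []
  accept := {.bottom, .positive}

variable {q : ℤ}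

/-- The element of `BS(1, q)` that a letter stands for. -/
def Letter.toBS (q : ℤ) : Letter → BS q
  | .down => (BS.a q ^ 2)⁻¹
  | .up => BS.a q ^ 2
  | .b => BS.b q
  | .bInv => (BS.b q)⁻¹
  | .a => BS.a q

/-- What is known about the element read so far in a configuration of `heightPDA`. -/
def HeightInv [NeZero q] (c : Phase × List Unit) (g : BS q) : Prop :=
  match c.1 with
  | .descend => ht g = -2 * c.2.length ∧ trans g = 0
  | .ascend => ht g = -2 * c.2.length ∧ 0 < trans g
  | .bottom => ht g = 0 ∧ 0 < trans g
  | .positive => 0 < ht g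

/-- Until `bottom` is reached the height is even, so each b read adds a positive power of q even if
q is negative. The test for an empty stack certifies height zero. -/
theorem HeightInv.step [NeZero q] {c d : Phase × List Unit} {o : Option Letter} {g : BS q}
    (hg : HeightInv c g) (h : heightPDA.Step c o d) :
    HeightInv d (g * (o.toList.map (Letter.toBS q)).prod) := by
  obtain ⟨v, hv, hd⟩ := h
  obtain ⟨s, u⟩ := c
  obtain ⟨s', u'⟩ := d
  have hpos : ∀ k : ℤ, Even k → 0 < (q : ℝ) ^ k := fun k hk => hk.zpow_pos cast_ne_zero
  obtain rfl | ⟨u, ⟨⟩, rfl⟩ := u.eq_nil_or_concat' <;>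
  rcases s with _ | _ | _ | _ <;> rcases o with _ | (_ | _ | _ | _ | _) <;>
    simp [heightPDA, heightPDAδ] at hv <;> obtain ⟨rfl, rfl⟩ := hv <;> simp at hd <;> subst hd <;>
    simp [HeightInv, Letter.toBS, trans_mul, trans_inv, trans_a_pow] at hg ⊢ <;>
    first
    | omega
    | exact ⟨by omega, hg.2⟩
    | exact ⟨by omega, by
        have := hpos (ht g) (by rw [Int.even_iff]; omega)
        linarith⟩

theorem HeightInv.run [NeZero q] {c d : Phase × List Unit} {w : List Letter} {g : BS q}
    (hg : HeightInv c g) (h : heightPDA.Run c w d) :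
    HeightInv d (g * (w.map (Letter.toBS q)).prod) := by
  induction h generalizing g with
  | nil => simpa using hg
  | cons hs _ ih =>
    rw [List.map_append, List.prod_append, ← mul_assoc]
    exact ih (hg.step hs)

theorem heightPDA_run_replicate (s : Phase) (x : Letter)
    (h : ∀ t, (s, t.toList) ∈ heightPDAδ s (some x) t) (u : List Unit) (n : ℕ) :
    heightPDA.Run (s, u) (List.replicate n x) (s, u) := by
  induction n with
  | zero => exact .nil _
  | succ n ih => exact .cons_of_keep (h _) ih

theorem heightPDA_run_descend (n : ℕ) : heightPDA.Run (.descend, []) (List.replicate n .down)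
    (.descend, List.replicate n ()) := by
  induction n with
  | zero => exact .nil _
  | succ n ih =>
    rw [List.replicate_succ']
    refine ih.trans (.of_mem_δ (o := some Letter.down) (v := () :: _) rfl ?_)
    cases n <;> simp [List.replicate_succ', List.getLast?_append]

theorem heightPDA_run_ascend (n : ℕ) : heightPDA.Run (.ascend, List.replicate n ())
    (List.replicate n .up) (.ascend, []) := by
  induction n with
  | zero => exact .nil _
  | succ n ih =>
    rw [List.replicate_succ (a := Letter.up)]
    refine .cons (o := some Letter.up) (c' := (Phase.ascend, List.replicate n ())) ⟨[], ?_, ?_⟩ ih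
    · simp [heightPDA, heightPDAδ, List.getLast?_replicate]
    · simp

theorem heightPDA_run_bottom (n m : ℕ) : heightPDA.Run (.descend, [])
    (List.replicate n .down ++ (.b :: List.replicate m .b ++ List.replicate n .up))
    (.bottom, []) := by
  refine (heightPDA_run_descend n).trans (.cons_of_keep (M := heightPDA) (s := .descend)
    (s' := .ascend) (x := .b) rfl
    ((heightPDA_run_replicate .ascend .b (fun _ => rfl) _ m).trans ?_))
  rw [← List.append_nil (List.replicate n Letter.up)]
  exact (heightPDA_run_ascend n).trans
    (.of_mem_δ (o := none) (v := []) rfl rfl)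

section NeZero

variable [NeZero q]

theorem exists_run_bottom {g : BS q} (h0 : ht g = 0) (hpos : 0 < trans g) :
    ∃ w : List Letter, heightPDA.Run (.descend, []) w (.bottom, []) ∧
      (w.map (Letter.toBS q)).prod = g := by
  obtain ⟨n, m, h⟩ := exists_trans_eq g
  -- Doubling the exponent makes it even, matching a descent in steps of a⁻² and making the power of
  -- q positive.
  obtain ⟨m, h⟩ := exists_trans_eq_of_le h (N := (2 * n : ℕ)) (by push_cast; omega)
  have hq : 0 < (q : ℝ) ^ (-((2 * n : ℕ) : ℤ)) := by
    refine Even.zpow_pos ?_ cast_ne_zero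
    rw [Int.even_iff]
    omega
  rw [h, mul_pos_iff_of_pos_left hq, Int.cast_pos] at hpos
  obtain ⟨m, rfl⟩ : ∃ j : ℕ, m = j + 1 := ⟨(m - 1).toNat, by omega⟩
  refine ⟨_, heightPDA_run_bottom n m, ?_⟩
  have he : (a q ^ (2 * n))⁻¹ * b q ^ (m + 1 : ℤ) * a q ^ ((2 * n : ℕ) : ℤ) = g :=
    ext_ht_trans (by simp [h0]) (by rw [trans_normal_form, h])
  rw [← he, add_comm, zpow_add, zpow_one, zpow_natCast, zpow_natCast]
  simp [Letter.toBS, pow_mul, mul_assoc]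

theorem exists_int_mul_lt {c : ℝ} (hc : c ≠ 0) (x : ℝ) : ∃ j : ℤ, c * j < x := by
  rcases lt_or_gt_of_ne hc with hc | hc
  · obtain ⟨j, hj⟩ := exists_int_gt (x / c)
    exact ⟨j, by rwa [div_lt_iff_of_neg' hc] at hj⟩
  · obtain ⟨j, hj⟩ := exists_int_lt (x / c)
    exact ⟨j, by rwa [lt_div_iff₀' hc] at hj⟩

theorem exists_run_positive {g : BS q} (hg : 0 < ht g) :
    ∃ w : List Letter, heightPDA.Run (.descend, []) w (.positive, []) ∧
      (w.map (Letter.toBS q)).prod = g := by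
  obtain ⟨k, hk⟩ : ∃ k : ℕ, ht g = k + 1 := ⟨(ht g - 1).toNat, by omega⟩
  obtain ⟨j, hj⟩ := exists_int_mul_lt (zpow_ne_zero (ht g) (cast_ne_zero (q := q))) (trans g)
  -- Write g = g'·aᵏ⁺¹·bʲ: the choice of `j` gives g' positive translation at height zero.
  obtain ⟨w, hw, hwg⟩ := exists_run_bottom (g := g * b q ^ (-j) * (a q ^ (k + 1))⁻¹)
    (by simp [hk]) (by
      rw [trans_mul, trans_mul, trans_inv, trans_a_pow, trans_b_zpow]
      push_cast
      linarith)
  obtain ⟨v, hv, hvj⟩ : ∃ v : List Letter, heightPDA.Run (.positive, []) v (.positive, []) ∧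
      (v.map (Letter.toBS q)).prod = b q ^ j := by
    rcases j.eq_nat_or_neg with ⟨j, rfl | rfl⟩
    · exact ⟨_, heightPDA_run_replicate .positive .b (fun _ => rfl) [] j, by simp [Letter.toBS]⟩
    · exact ⟨_, heightPDA_run_replicate .positive .bInv (fun _ => rfl) [] j, by simp [Letter.toBS]⟩
  refine ⟨w ++ (.a :: List.replicate k .a ++ v), hw.trans (.cons_of_keep
    (M := heightPDA) (s := .bottom) (s' := .positive) (x := .a) rfl
    ((heightPDA_run_replicate .positive .a (fun _ => rfl) [] k).trans hv)), ?_⟩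
  simp only [List.map_append, List.prod_append, hwg, hvj, List.cons_append, List.map_cons,
    List.prod_cons, List.map_replicate, List.prod_replicate, Letter.toBS]
  rw [← mul_assoc (a q), ← pow_succ']
  simp

theorem image_accepts_heightPDA :
    {g : BS q | ∃ w ∈ heightPDA.accepts, (w.map (Letter.toBS q)).prod = g} = heightCone q := by
  ext g
  constructor
  · rintro ⟨w, ⟨⟨s, u⟩, hrun, hs⟩, rfl⟩
    have h0 : HeightInv (q := q) (heightPDA.start, heightPDA.stack₀) 1 := by
      simp [HeightInv, heightPDA]
    have := h0.run hrun
    rw [one_mul] at this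
    rcases hs with rfl | rfl
    · exact Or.inr this
    · exact Or.inl this
  · rintro (h | ⟨h0, h⟩)
    · obtain ⟨w, hw, he⟩ := exists_run_positive h
      exact ⟨w, ⟨_, hw, Or.inr rfl⟩, he⟩
    · obtain ⟨w, hw, he⟩ := exists_run_bottom h0 h
      exact ⟨w, ⟨_, hw, Or.inl rfl⟩, he⟩

theorem isOneCounterLeftOrder_heightCone {X : Type*} (π : FreeMonoid X →* BS q)
    (hπ : Function.Surjective π) :
    IsOneCounterLeftOrder π (fun g h : BS q => g⁻¹ * h ∈ heightCone q) := by
  refine ⟨isLeftOrder_heightCone, ?_⟩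
  choose f hf using fun x : Letter => hπ (x.toBS q)
  have hL : IsOneCounter heightPDA.accepts :=
    ⟨Phase, Unit, inferInstance, heightPDA, by simp, rfl⟩
  refine ⟨_, hL.substitute fun x => (f x).toList, ?_⟩
  have hval : ∀ w : List Letter, π (FreeMonoid.ofList (w.flatMap fun x => (f x).toList)) =
      (w.map (Letter.toBS q)).prod := by
    intro w
    induction w with
    | nil => exact map_one π
    | cons x w ih =>
      rw [List.flatMap_cons, FreeMonoid.ofList_append, map_mul, ih, FreeMonoid.ofList_toList, hf,
        List.map_cons, List.prod_cons]
  rw [posCone_inv_mul_mem, ← image_accepts_heightPDA]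
  ext g
  constructor
  · rintro ⟨_, ⟨w, hw, rfl⟩, rfl⟩
    exact ⟨w, hw, (hval w).symm⟩
  · rintro ⟨w, hw, rfl⟩
    exact ⟨_, ⟨w, hw, rfl⟩, hval w⟩

end NeZero

end BS

/-! ### The main theorem -/

theorem mainTheorem2 (q : ℤ) {X : Type*} [Finite X] (π : FreeMonoid X →* BS q)
    (hπ : Function.Surjective π) :
    (∃ lt : BS q → BS q → Prop, IsOneCounterLeftOrder π lt) ∧
    ((∃ lt : BS q → BS q → Prop, IsRegularLeftOrder π lt) ↔ -1 ≤ q) ∧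
    (∀ hq : 2 ≤ q, ∀ lt : BS q → BS q → Prop, IsRegularLeftOrder π lt →
      IsInducedBy (bsAffine q (by omega)) lt) := by
  refine ⟨?_, ⟨?_, BS.exists_isRegularLeftOrder π hπ⟩, ?_⟩
  · by_cases hq : -1 ≤ q
    · obtain ⟨lt, H, L, hL, hP⟩ := BS.exists_isRegularLeftOrder π hπ hq
      exact ⟨lt, H, L, hL.isOneCounter, hP⟩
    · have : NeZero q := ⟨by omega⟩
      exact ⟨_, BS.isOneCounterLeftOrder_heightCone π hπ⟩
  · rintro ⟨lt, hlt⟩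
    by_contra hq
    have : NeZero q := ⟨by omega⟩
    have habs : 2 ≤ |q| := by
      rw [abs_of_neg (by omega)]
      omega
    rcases BS.exists_sign_or_induced habs hlt.1 with ⟨ε, hε, h⟩ | ⟨h, -⟩
    · exact BS.not_isRegularLeftOrder_of_sign habs hε h hlt
    · omega
  · intro hq lt hlt
    have : NeZero q := ⟨by omega⟩
    have habs : 2 ≤ |q| := by rwa [abs_of_pos (by omega)]
    rcases BS.exists_sign_or_induced habs hlt.1 with ⟨ε, hε, h⟩ | ⟨_, h⟩
    · exact absurd hlt (BS.not_isRegularLeftOrder_of_sign habs hε h)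
    · exact h
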